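/- Let $n\ge 3$ and let $M$ be a smooth $n$-manifold. A generalized Kerr--Schild (GKS) spacetime on $M$ consists of a smooth Lorentzian metric $\bar{\mathbf g}$ (the background, signature $(-,+,\dots,+)$), a smooth nowhere vanishing vector field $\mathbf k$ that is null for $\bar{\mathbf g}$ (also regarded as the $1$-form $k_a=\bar g_{ab}k^b$), and smooth functions $H=H_\mu$ on $M$ depending on parameters $\mu$ (constants or functions on $M$; $\mu$ ranges over a topological space in which the value $\mu=0$ is not isolated), with $H_0=0$; at each point of $M$ the values and the derivatives of $H_\mu$ up to order two tend to $0$ as $\mu\to 0$. The background $\bar{\mathbf g}$ and $\mathbf k$ do not depend on $\mu$. The full geometry is $$\mathbf g=\mathbf g_\mu=\bar{\mathbf g}-2H_\mu\,\mathbf k\otimes\mathbf k .$$ For a Lorentzian metric with Ricci tensor $R_{ab}$, a nonzero null vector $\mathbf l$ at a point is a Ricci aligned null direction (Ricci AND) if $R_{ab}l^al^b=0$. In a null frame $\{\mathbf l,\mathbf r,\mathbf m_{(i)}\}_{i=2,\dots,n-1}$ ($\mathbf l,\mathbf r$ null, $\mathbf l\cdot\mathbf r=1$, $\mathbf m_{(i)}$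 orthonormal and orthogonal to $\mathbf l$ and $\mathbf r$), a Ricci AND is called multiple if $R_{ab}l^am_{(i)}^b=0$ for all $i$, and single otherwise. Assume that $\mathbf k$ is geodesic, i.e. $k^b\bar\nabla_bk^a$ is proportional to $k^a$ (the condition is the same for $\bar{\mathbf g}$ and $\mathbf g$; no affine parametrization is required). Then: 1. For every $\mu$, at every point, $\mathbf k$ is a single Ricci AND of $\bar{\mathbf g}$ if and only if it is a single Ricci AND of $\mathbf g_\mu$. 2. For every $\mu$, at every point, $\mathbf k$ is a multiple Ricci AND of $\bar{\mathbf g}$ if and only if it is a multiple Ricci AND of $\mathbf g_\mu$. 3. At a point $x$, for all parameter values $\mu\ne 0$, let $\mathbf l=\mathbf l_\mu$ be a Ricci AND of $\mathbf g_\mu$ that is not proportional to $\mathbf k$. Then $\mathbf l\cdot\mathbf k\neq 0$. Normalize $\mathbf l$ so that $\mathbf l\cdot\mathbf k=1$, and suppose that $\bar{\mathbf l}=\mathbf l-H\mathbf k$, as an object of the background, does not depend on the parameters $\mu\neq 0$. Then $\bar{\mathbf l}$ is a null vector of $\bar{\mathbf g}$ and a Ricci AND of the background. -/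

import Mathlib

open scoped Manifold ContDiff Topology
open Bundle Filter

noncomputable section

namespace KerrSchild

/-- Fields of bilinear forms on the tangent spaces of an `n`-manifold
(covariant tensor fields of rank two, no regularity required). -/
abbrev BilinField (n : ℕ) (M : Type*) [TopologicalSpace M]
    [ChartedSpace (EuclideanSpace ℝ (Fin n)) M] :=
  ∀ x : M, TangentSpace (𝓡 n) x →L[ℝ] TangentSpace (𝓡 n) x →L[ℝ] ℝ

/-- Vector fields on an `n`-manifold (no regularity required). -/
abbrev VecField (n : ℕ) (M : Type*) [TopologicalSpace M]
    [ChartedSpace (EuclideanSpace ℝ (Fin n)) M] :=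
  ∀ x : M, TangentSpace (𝓡 n) x

section Geometry

variable {n : ℕ} {M : Type*} [TopologicalSpace M]
  [ChartedSpace (EuclideanSpace ℝ (Fin n)) M] [IsManifold (𝓡 n) ∞ M]

/-- `g` is a smooth Lorentzian metric of signature `(-,+,…,+)`: a smooth field of symmetric
bilinear forms which at every point has a basis orthonormal in the Lorentzian sense. -/
def IsLorentzMetric (g : BilinField n M) : Prop :=
  ContMDiff (𝓡 n)
      ((𝓡 n).prod 𝓘(ℝ, EuclideanSpace ℝ (Fin n) →L[ℝ] EuclideanSpace ℝ (Fin n) →L[ℝ] ℝ)) ∞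
      (fun x ↦ TotalSpace.mk'
        (EuclideanSpace ℝ (Fin n) →L[ℝ] EuclideanSpace ℝ (Fin n) →L[ℝ] ℝ)
        (E := fun x : M ↦ TangentSpace (𝓡 n) x →L[ℝ] TangentSpace (𝓡 n) x →L[ℝ] ℝ) x (g x)) ∧
  (∀ x v w, g x v w = g x w v) ∧
  ∀ x, ∃ b : Module.Basis (Fin n) ℝ (TangentSpace (𝓡 n) x),
    ∀ i j, g x (b i) (b j) = if i = j then (if (i : ℕ) = 0 then -1 else 1) else 0

/-- A smooth vector field. -/
def IsSmoothVecField (X : VecField n M) : Prop :=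
  ContMDiff (𝓡 n) (𝓡 n).tangent ∞
    (fun x ↦ (⟨x, X x⟩ : TangentBundle (𝓡 n) M))

/-! ### Coordinates, Christoffel symbols, Ricci tensor

All coordinate expressions at a point `p` refer to the chart `φ = extChartAt (𝓡 n) p` around `p`;
`y` is a point of the coordinate space. -/

/-- The coordinate vector `∂_i` of the chart around `p`, at the point `q` of the chart domain
(the inverse of the tangent bundle trivialization at `q` is the differential of `φ⁻¹`). -/
def coordVec (p q : M) (i : Fin n) : TangentSpace (𝓡 n) q :=
  (trivializationAt (EuclideanSpace ℝ (Fin n)) (TangentSpace (𝓡 n)) p).symmL ℝ q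
    (EuclideanSpace.single i 1)

/-- The component `v^a` of a tangent vector `v` at `q` in the chart around `p`
(the tangent bundle trivialization at `q` is the differential of `φ`). -/
def comp (p q : M) (v : TangentSpace (𝓡 n) q) (a : Fin n) : ℝ :=
  (trivializationAt (EuclideanSpace ℝ (Fin n)) (TangentSpace (𝓡 n)) p).continuousLinearMapAt ℝ q v a

/-- The partial derivative `∂_i f` of a function on coordinate space. -/
def pd (i : Fin n) (f : EuclideanSpace ℝ (Fin n) → ℝ) (y : EuclideanSpace ℝ (Fin n)) : ℝ :=
  fderiv ℝ f y (EuclideanSpace.single i 1)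

/-- The matrix `g_{ij}` of metric components in the chart around `p`. -/
def metricMat (g : BilinField n M) (p : M) (y : EuclideanSpace ℝ (Fin n)) :
    Matrix (Fin n) (Fin n) ℝ :=
  fun i j ↦ g ((extChartAt (𝓡 n) p).symm y)
    (coordVec p ((extChartAt (𝓡 n) p).symm y) i) (coordVec p ((extChartAt (𝓡 n) p).symm y) j)

/-- The Christoffel symbols
`Γ^a_{bc} = ½ g^{ad} (∂_b g_{dc} + ∂_c g_{db} - ∂_d g_{bc})`. -/
def christoffel (g : BilinField n M) (p : M) (a b c : Fin n) (y : EuclideanSpace ℝ (Fin n)) : ℝ :=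
  (1 / 2) * ∑ d, (metricMat g p y)⁻¹ a d *
    (pd b (fun z ↦ metricMat g p z d c) y + pd c (fun z ↦ metricMat g p z d b) y
      - pd d (fun z ↦ metricMat g p z b c) y)

/-- The components of the Ricci tensor,
`R_{bc} = ∂_a Γ^a_{bc} - ∂_c Γ^a_{ba} + Γ^a_{ad} Γ^d_{bc} - Γ^a_{cd} Γ^d_{ba}`. -/
def ricciComp (g : BilinField n M) (p : M) (b c : Fin n) (y : EuclideanSpace ℝ (Fin n)) : ℝ :=
  ∑ a, (pd a (christoffel g p a b c) y - pd c (christoffel g p a b a) y)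
    + ∑ a, ∑ d, (christoffel g p a a d y * christoffel g p d b c y
      - christoffel g p a c d y * christoffel g p d b a y)

/-- The Ricci tensor `R_{bc} v^b w^c` of the Levi-Civita connection of `g` at the point `p`. -/
def ricci (g : BilinField n M) (p : M) (v w : TangentSpace (𝓡 n) p) : ℝ :=
  ∑ b, ∑ c, comp p p v b * comp p p w c * ricciComp g p b c (extChartAt (𝓡 n) p p)

/-- The component `v^b X^a_{;b} = v^b (∂_b X^a + Γ^a_{bc} X^c)` at `p` of the covariant
derivative of the vector field `X` in the direction `v`. -/
def covDerivComp (g : BilinField n M) (X : VecField n M) (p : M) (v : TangentSpace (𝓡 n) p)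
    (a : Fin n) : ℝ :=
  ∑ b, comp p p v b *
    (pd b (fun y ↦ comp p ((extChartAt (𝓡 n) p).symm y) (X ((extChartAt (𝓡 n) p).symm y)) a)
        (extChartAt (𝓡 n) p p)
      + ∑ c, christoffel g p a b c (extChartAt (𝓡 n) p p) * comp p p (X p) c)

/-- The vector field `k` is geodesic for `g`: `k^b k^a_{;b}` is everywhere proportional to `k^a`
(no affine parametrization is required). -/
def IsGeodesic (g : BilinField n M) (k : VecField n M) : Prop :=
  ∀ p, ∃ c : ℝ, ∀ a, covDerivComp g k p (k p) a = c * comp p p (k p) a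

/-! ### Null frames and aligned null directions of the Ricci tensor -/

/-- `{l, r, m_i}` is a null frame at `x`: `l`, `r` are null with `l · r = 1`, and the `n - 2`
vectors `m_i` are orthonormal and orthogonal to `l` and `r`. -/
def IsNullFrame (g : BilinField n M) (x : M) (l r : TangentSpace (𝓡 n) x)
    (m : Fin (n - 2) → TangentSpace (𝓡 n) x) : Prop :=
  g x l l = 0 ∧ g x r r = 0 ∧ g x l r = 1 ∧
  (∀ i, g x (m i) l = 0 ∧ g x (m i) r = 0) ∧
  ∀ i j, g x (m i) (m j) = if i = j then 1 else 0

/-- `l` spans an aligned null direction (AND) of the Ricci tensor of `g` at `x`: it is a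
nonzero null vector and the boost weight `+2` component `R_{00} = R_{ab} l^a l^b` vanishes. -/
def IsRicciAND (g : BilinField n M) (x : M) (l : TangentSpace (𝓡 n) x) : Prop :=
  l ≠ 0 ∧ g x l l = 0 ∧ ricci g x l l = 0

/-- Single Ricci AND: `R_{00} = 0`, but not all of the boost weight `+1` components
`R_{0i} = R_{ab} l^a m_i^b` vanish in a null frame `{l, r, m_i}`. -/
def IsSingleRicciAND (g : BilinField n M) (x : M) (l : TangentSpace (𝓡 n) x) : Prop :=
  IsRicciAND g x l ∧ ∃ r m, IsNullFrame g x l r m ∧ ∃ i, ricci g x l (m i) ≠ 0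

/-- Multiple Ricci AND (multiplicity at least two, the vanishing Ricci tensor included):
`R_{00} = 0` and `R_{0i} = 0` in the null frames `{l, r, m_i}`. -/
def IsMultipleRicciAND (g : BilinField n M) (x : M) (l : TangentSpace (𝓡 n) x) : Prop :=
  IsRicciAND g x l ∧ ∀ r m, IsNullFrame g x l r m → ∀ i, ricci g x l (m i) = 0

end Geometry

/-! ### Generalized Kerr-Schild spacetimes -/

/-- A generalized Kerr-Schild (GKS) spacetime: a Lorentzian background metric `gbar`, a smooth
nowhere vanishing null vector field `k`, and scalar functions `H μ` depending on parameters `μ`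
with values in a space `P`, such that `H` vanishes at the value `origin` of the parameters
(`μ = 0` in the physical notation). Neither `gbar` nor `k` depends on the parameters.

`P` is an arbitrary topological space in which `origin` is not isolated, so that tuples of
constants and tuples of functions on spacetime ("local parameters") are both covered. The
dependence of `H` on the parameters is continuous at `origin` in the sense that the values and
the derivatives of `H μ` up to order two tend to those of `H origin = 0` at every point. -/
structure GKSSpacetime (n : ℕ) (M : Type*) [TopologicalSpace M]
    [ChartedSpace (EuclideanSpace ℝ (Fin n)) M] [IsManifold (𝓡 n) ∞ M]
    (P : Type*) [TopologicalSpace P] where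
  /-- the background metric -/
  gbar : BilinField n M
  isLorentz : IsLorentzMetric gbar
  /-- the Kerr-Schild vector field -/
  k : VecField n M
  smooth_k : IsSmoothVecField k
  k_ne_zero : ∀ x, k x ≠ 0
  k_null : ∀ x, gbar x (k x) (k x) = 0
  /-- the parameter value at which the full geometry reduces to the background -/
  origin : P
  origin_not_isolated : (𝓝[≠] origin).NeBot
  /-- the Kerr-Schild function for each value of the parameters -/
  H : P → M → ℝ
  smooth_H : ∀ μ, ContMDiff (𝓡 n) 𝓘(ℝ) ∞ (H μ)
  H_origin : ∀ x, H origin x = 0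
  tendsto_H : ∀ (x : M) (j : ℕ), j ≤ 2 →
    Tendsto (fun μ ↦ iteratedFDeriv ℝ j (fun y ↦ H μ ((extChartAt (𝓡 n) x).symm y))
      (extChartAt (𝓡 n) x x)) (𝓝 origin) (𝓝 0)

/-- The full metric `g = gbar - 2 H k ⊗ k` at the parameter value `μ`; in the tensor product
`k` stands for the `1`-form `gbar(k, ·)`. -/
def GKSSpacetime.g {n : ℕ} {M : Type*} [TopologicalSpace M]
    [ChartedSpace (EuclideanSpace ℝ (Fin n)) M] [IsManifold (𝓡 n) ∞ M]
    {P : Type*} [TopologicalSpace P] (S : GKSSpacetime n M P) (μ : P) : BilinField n M :=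
  fun x ↦ S.gbar x - (2 * S.H μ x) • (S.gbar x (S.k x)).smulRight (S.gbar x (S.k x))

end KerrSchild

end

/-! In a chart the full metric is `G + f κ ⊗ κ` with `f = -2H` and `κ` the covector of the null
field `K`. Since `κ(K) = 0`, its inverse is exactly `G⁻¹ - f K ⊗ K`, so the difference `C` of the
two Levi-Civita connections has a closed form (`chris_ksMat`). The geodesic condition says that
contracting `K` with `dκ` gives `λ κ`. With nullity it yields three contractions: `K^b C^a_{bc} = θ
K^a κ_c`, `C^a_{ac} = 0`, and `C^a_{bc} ∇_a K^b = τ κ_c`. Inserted in the Ricci tensor, they show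
that `K^b R_{bc}` changes only by a multiple of `κ_c` (`sum_K_ric_ksMat`). Hence `R(k, w)` is the
same for both metrics whenever `w` is orthogonal to `k` (`ricci_k`). Taking `w = k` and `w = m_i`
gives `R_{00}` and `R_{0i}`; null frames containing `k` correspond under `r ↦ r + H k` with the same
`m_i`. This proves the first two claims. For the third, a null vector orthogonal to `k` is
proportional to `k`, so `l · k ≠ 0`. The vector `lbar + H k` is a multiple of `l`, so the Ricci form
of the full metric vanishes on it for every `μ ≠ origin`. Every term of `C` carries `f` or a first
derivative of `f`, so two derivatives of `H` control the Ricci tensor (`tendsto_ric_ksMat`). Letting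
`μ` tend to the origin, which is not isolated, gives `R(lbar, lbar) = 0` for the background. -/

noncomputable section

namespace KerrSchild

/-! ### Coordinate calculus: connection, null vector field and Kerr-Schild metric on an open set -/

section LocalCalculus

variable {n : ℕ}

/-! ### Partial derivatives -/

theorem pd_add {f g : EuclideanSpace ℝ (Fin n) → ℝ} {y : EuclideanSpace ℝ (Fin n)} (i : Fin n)
    (hf : DifferentiableAt ℝ f y) (hg : DifferentiableAt ℝ g y) :
    pd i (fun z ↦ f z + g z) y = pd i f y + pd i g y := by
  simp [pd, fderiv_fun_add hf hg]

theorem pd_mul {f g : EuclideanSpace ℝ (Fin n) → ℝ} {y : EuclideanSpace ℝ (Fin n)} (i : Fin n)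
    (hf : DifferentiableAt ℝ f y) (hg : DifferentiableAt ℝ g y) :
    pd i (fun z ↦ f z * g z) y = pd i f y * g y + f y * pd i g y := by
  simp [pd, fderiv_fun_mul hf hg]
  ring

theorem pd_sum {ι : Type*} {s : Finset ι} {f : ι → EuclideanSpace ℝ (Fin n) → ℝ}
    {y : EuclideanSpace ℝ (Fin n)} (i : Fin n) (hf : ∀ j, DifferentiableAt ℝ (f j) y) :
    pd i (fun z ↦ ∑ j ∈ s, f j z) y = ∑ j ∈ s, pd i (f j) y := by
  simp [pd, fderiv_fun_sum (fun j _ ↦ hf j)]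

theorem pd_congr {f g : EuclideanSpace ℝ (Fin n) → ℝ} {y : EuclideanSpace ℝ (Fin n)} (i : Fin n)
    (h : f =ᶠ[𝓝 y] g) : pd i f y = pd i g y := by
  simp [pd, h.fderiv_eq]

theorem pd_const (i : Fin n) (c : ℝ) (y : EuclideanSpace ℝ (Fin n)) :
    pd i (fun _ ↦ c) y = 0 := by
  simp [pd]

theorem contDiffAt_pd {f : EuclideanSpace ℝ (Fin n) → ℝ} {y : EuclideanSpace ℝ (Fin n)}
    (i : Fin n) (hf : ContDiffAt ℝ ∞ f y) : ContDiffAt ℝ ∞ (pd i f) y :=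
  (hf.fderiv_right (m := ∞) le_rfl).clm_apply contDiffAt_const

theorem smooth_diff {f : EuclideanSpace ℝ (Fin n) → ℝ} {y : EuclideanSpace ℝ (Fin n)}
    (hf : ContDiffAt ℝ ∞ f y) : DifferentiableAt ℝ f y :=
  hf.differentiableAt (by simp)

/-! ### Christoffel symbols and Ricci tensor of a matrix valued function -/

/-- Christoffel symbols of a metric given by its coordinate matrix. -/
def chris (G : EuclideanSpace ℝ (Fin n) → Matrix (Fin n) (Fin n) ℝ) (a b c : Fin n)
    (y : EuclideanSpace ℝ (Fin n)) : ℝ :=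
  (1 / 2) * ∑ d, (G y)⁻¹ a d *
    (pd b (fun z ↦ G z d c) y + pd c (fun z ↦ G z d b) y - pd d (fun z ↦ G z b c) y)

/-- Ricci components of a metric given by its coordinate matrix. -/
def ric (G : EuclideanSpace ℝ (Fin n) → Matrix (Fin n) (Fin n) ℝ) (b c : Fin n)
    (y : EuclideanSpace ℝ (Fin n)) : ℝ :=
  ∑ a, (pd a (chris G a b c) y - pd c (chris G a b a) y)
    + ∑ a, ∑ d, (chris G a a d y * chris G d b c y - chris G a c d y * chris G d b a y)

/-- The covector obtained from the vector field `K` by lowering the index. -/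
def low (G : EuclideanSpace ℝ (Fin n) → Matrix (Fin n) (Fin n) ℝ)
    (K : EuclideanSpace ℝ (Fin n) → Fin n → ℝ) (i : Fin n) (y : EuclideanSpace ℝ (Fin n)) : ℝ :=
  ∑ j, G y i j * K y j

/-- The Kerr-Schild metric `G + f κ ⊗ κ` with `κ = low G K`. -/
def ksMat (G : EuclideanSpace ℝ (Fin n) → Matrix (Fin n) (Fin n) ℝ)
    (K : EuclideanSpace ℝ (Fin n) → Fin n → ℝ) (f : EuclideanSpace ℝ (Fin n) → ℝ)
    (y : EuclideanSpace ℝ (Fin n)) : Matrix (Fin n) (Fin n) ℝ :=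
  fun i j ↦ G y i j + f y * (low G K i y * low G K j y)

/-- Components of the exterior derivative of a covector field. -/
def dcov (κ : Fin n → EuclideanSpace ℝ (Fin n) → ℝ) (b d : Fin n)
    (y : EuclideanSpace ℝ (Fin n)) : ℝ :=
  pd b (κ d) y - pd d (κ b) y

/-- Components `∂_b k^a + Γ^a_{bc} k^c` of the covariant derivative. -/
def cov (G : EuclideanSpace ℝ (Fin n) → Matrix (Fin n) (Fin n) ℝ)
    (K : EuclideanSpace ℝ (Fin n) → Fin n → ℝ) (b a : Fin n) (y : EuclideanSpace ℝ (Fin n)) : ℝ :=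
  pd b (fun z ↦ K z a) y + ∑ c, chris G a b c y * K y c

/-- A smooth nondegenerate metric with a smooth null vector field on an open subset of
coordinate space. -/
structure IsLocalKS (G : EuclideanSpace ℝ (Fin n) → Matrix (Fin n) (Fin n) ℝ)
    (K : EuclideanSpace ℝ (Fin n) → Fin n → ℝ) (U : Set (EuclideanSpace ℝ (Fin n))) : Prop where
  isOpen : IsOpen U
  smooth_G : ∀ y ∈ U, ∀ i j, ContDiffAt ℝ ∞ (fun z ↦ G z i j) y
  symm : ∀ y i j, G y i j = G y j i
  det : ∀ y ∈ U, IsUnit (G y).det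
  smooth_K : ∀ y ∈ U, ∀ i, ContDiffAt ℝ ∞ (fun z ↦ K z i) y
  null : ∀ y ∈ U, ∑ a, low G K a y * K y a = 0

theorem sum_mul_inv {A : Matrix (Fin n) (Fin n) ℝ} (hA : IsUnit A.det) (v : Fin n → ℝ)
    (e : Fin n) : ∑ a, A e a * ∑ d, A⁻¹ a d * v d = v e := by
  have := congrFun (congrArg (fun B ↦ B.mulVec v) (Matrix.mul_nonsing_inv A hA)) e
  simp only [← Matrix.mulVec_mulVec, Matrix.one_mulVec] at this
  exact this

theorem sum_inv_mul {A : Matrix (Fin n) (Fin n) ℝ} (hA : IsUnit A.det) (v : Fin n → ℝ)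
    (e : Fin n) : ∑ a, A⁻¹ e a * ∑ d, A a d * v d = v e := by
  have := congrFun (congrArg (fun B ↦ B.mulVec v) (Matrix.nonsing_inv_mul A hA)) e
  simp only [← Matrix.mulVec_mulVec, Matrix.one_mulVec] at this
  exact this

theorem eq_of_sum_mul_eq {A : Matrix (Fin n) (Fin n) ℝ} (hA : IsUnit A.det) {v w : Fin n → ℝ}
    (h : ∀ e, ∑ a, A e a * v a = ∑ a, A e a * w a) (a : Fin n) : v a = w a := by
  rw [← sum_inv_mul hA v, ← sum_inv_mul hA w]
  simp_rw [h]

variable {G : EuclideanSpace ℝ (Fin n) → Matrix (Fin n) (Fin n) ℝ}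
  {K : EuclideanSpace ℝ (Fin n) → Fin n → ℝ} {U : Set (EuclideanSpace ℝ (Fin n))}
  {f : EuclideanSpace ℝ (Fin n) → ℝ} {y : EuclideanSpace ℝ (Fin n)}

theorem lower_chris (hG : IsUnit (G y).det) (e b c : Fin n) :
    ∑ a, G y e a * chris G a b c y = (1 / 2) *
      (pd b (fun z ↦ G z e c) y + pd c (fun z ↦ G z e b) y - pd e (fun z ↦ G z b c) y) := by
  rw [← sum_mul_inv hG (fun d ↦ (1 / 2) *
    (pd b (fun z ↦ G z d c) y + pd c (fun z ↦ G z d b) y - pd d (fun z ↦ G z b c) y)) e]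
  simp only [chris, Finset.mul_sum]
  exact Finset.sum_congr rfl fun a _ ↦ Finset.sum_congr rfl fun d _ ↦ by ring

theorem chris_symm (hs : ∀ y i j, G y i j = G y j i) (a b c : Fin n)
    (y : EuclideanSpace ℝ (Fin n)) : chris G a b c y = chris G a c b y := by
  have h : ∀ i j, (fun z ↦ G z i j) = fun z ↦ G z j i := fun i j ↦ funext fun z ↦ hs z i j
  simp only [chris]
  rw [h b c]
  congr 1
  exact Finset.sum_congr rfl fun d _ ↦ by ring

/-- Cramer's rule: entries of the inverse are quotients of determinants, which are polynomials in
the entries. -/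
theorem contDiffAt_inv (hG : ∀ i j, ContDiffAt ℝ ∞ (fun z ↦ G z i j) y) (hd : IsUnit (G y).det)
    (i j : Fin n) : ContDiffAt ℝ ∞ (fun z ↦ (G z)⁻¹ i j) y := by
  have hdet : ∀ A : EuclideanSpace ℝ (Fin n) → Matrix (Fin n) (Fin n) ℝ,
      (∀ i j, ContDiffAt ℝ ∞ (fun z ↦ A z i j) y) → ContDiffAt ℝ ∞ (fun z ↦ (A z).det) y := by
    intro A hA
    simp only [Matrix.det_apply, Units.smul_def, zsmul_eq_mul]
    exact ContDiffAt.sum fun σ _ ↦ contDiffAt_const.mul (contDiffAt_prod fun i _ ↦ hA _ _)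
  have : (fun z ↦ (G z)⁻¹ i j) = fun z ↦ (G z).det⁻¹ * ((G z).updateRow j (Pi.single i 1)).det := by
    funext z
    simp [Matrix.inv_def, Matrix.adjugate_apply]
  rw [this]
  refine ((hdet G hG).inv hd.ne_zero).mul (hdet _ fun a b ↦ ?_)
  by_cases h : a = j
  · subst h; simpa using contDiffAt_const
  · simpa [Matrix.updateRow_ne h] using hG a b

theorem contDiffAt_chris (hG : ∀ i j, ContDiffAt ℝ ∞ (fun z ↦ G z i j) y)
    (hd : IsUnit (G y).det) (a b c : Fin n) : ContDiffAt ℝ ∞ (chris G a b c) y :=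
  contDiffAt_const.mul (ContDiffAt.sum fun d _ ↦ (contDiffAt_inv hG hd a d).mul
    (((contDiffAt_pd b (hG d c)).add (contDiffAt_pd c (hG d b))).sub (contDiffAt_pd d (hG b c))))

namespace IsLocalKS

theorem smooth_low (h : IsLocalKS G K U) (hy : y ∈ U) (i : Fin n) :
    ContDiffAt ℝ ∞ (low G K i) y :=
  ContDiffAt.sum fun j _ ↦ (h.smooth_G y hy i j).mul (h.smooth_K y hy j)

theorem smooth_dcov (h : IsLocalKS G K U) (hy : y ∈ U) (i j : Fin n) :
    ContDiffAt ℝ ∞ (dcov (low G K) i j) y :=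
  (contDiffAt_pd i (h.smooth_low hy j)).sub (contDiffAt_pd j (h.smooth_low hy i))

theorem smooth_ksMat (h : IsLocalKS G K U) (hy : y ∈ U) (hf : ContDiffAt ℝ ∞ f y) (i j : Fin n) :
    ContDiffAt ℝ ∞ (fun z ↦ ksMat G K f z i j) y :=
  (h.smooth_G y hy i j).add (hf.mul ((h.smooth_low hy i).mul (h.smooth_low hy j)))

theorem symm_ksMat (h : IsLocalKS G K U) (y) (i j : Fin n) :
    ksMat G K f y i j = ksMat G K f y j i := by
  simp only [ksMat, h.symm y i j]; ring

/-- The Sherman–Morrison inverse of a rank one perturbation; its denominator is `1` because `κ(K) =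
0`, so it is affine in `f`. -/
theorem ksMat_mul (h : IsLocalKS G K U) (hy : y ∈ U) :
    ksMat G K f y * ((G y)⁻¹ - f y • Matrix.vecMulVec (K y) (K y)) = 1 := by
  have e1 : ksMat G K f y = G y + f y • Matrix.vecMulVec ((G y).mulVec (K y))
      ((G y).mulVec (K y)) := by
    ext i j; simp [ksMat, low, Matrix.vecMulVec_apply, Matrix.mulVec, dotProduct]
  have hT : (G y).transpose = G y := by ext i j; exact h.symm y j i
  have hn : (G y).mulVec (K y) ⬝ᵥ K y = 0 := h.null y hy
  have hv : Matrix.vecMul ((G y).mulVec (K y)) (G y)⁻¹ = K y := by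
    conv_lhs => rw [← hT, Matrix.mulVec_transpose, hT]
    rw [Matrix.vecMul_vecMul, Matrix.mul_nonsing_inv _ (h.det y hy), Matrix.vecMul_one]
  rw [e1, add_mul, mul_sub, mul_sub, Matrix.mul_nonsing_inv _ (h.det y hy)]
  have hz : Matrix.vecMulVec ((G y).mulVec (K y)) ((G y).mulVec (K y))
      * Matrix.vecMulVec (K y) (K y) = 0 := by
    rw [Matrix.vecMulVec_mul_vecMulVec, hn, zero_smul, Matrix.vecMulVec_zero]
  simp [Matrix.vecMulVec_mul, hv, hz, Matrix.mul_vecMulVec (G y)]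

theorem det_ksMat (h : IsLocalKS G K U) (hy : y ∈ U) : IsUnit (ksMat G K f y).det :=
  (Matrix.isUnit_iff_isUnit_det _).1 (IsUnit.of_mul_eq_one _ (h.ksMat_mul hy))

theorem inv_ksMat (h : IsLocalKS G K U) (hy : y ∈ U) (a d : Fin n) :
    (ksMat G K f y)⁻¹ a d = (G y)⁻¹ a d - f y * (K y a * K y d) := by
  rw [Matrix.inv_eq_right_inv (h.ksMat_mul hy)]
  simp [Matrix.vecMulVec_apply]

/-- By nullity `κ` is the covector of `K` for both metrics. -/
theorem ksMat_mul_K (h : IsLocalKS G K U) (hy : y ∈ U) (e : Fin n) :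
    ∑ a, ksMat G K f y e a * K y a = low G K e y := by
  have : ∑ a, ksMat G K f y e a * K y a
      = (∑ a, G y e a * K y a) + f y * low G K e y * ∑ a, low G K a y * K y a := by
    simp only [ksMat, Finset.mul_sum, ← Finset.sum_add_distrib]
    exact Finset.sum_congr rfl fun a _ ↦ by ring
  rw [this, h.null y hy, mul_zero, add_zero]; rfl

/-- `k^b Γ_{abc} k^a = k^b ∂_c k_b`. -/
theorem sum_K_low_chris (h : IsLocalKS G K U) (hy : y ∈ U) (c : Fin n) :
    ∑ b, K y b * ∑ a, low G K a y * chris G a b c y = ∑ b, K y b * pd c (low G K b) y := by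
  have hpd : ∀ b, pd c (low G K b) y
      = ∑ e, (pd c (fun z ↦ G z b e) y * K y e + G y b e * pd c (fun z ↦ K z e) y) := by
    intro b
    rw [show low G K b = fun z ↦ ∑ j, G z b j * K z j from rfl, pd_sum]
    · exact Finset.sum_congr rfl fun e _ ↦ pd_mul c (smooth_diff (h.smooth_G y hy b e))
        (smooth_diff (h.smooth_K y hy e))
    · exact fun j ↦ smooth_diff ((h.smooth_G y hy b j).mul (h.smooth_K y hy j))
  -- Differentiate `κ(K) = 0`, which holds on a whole neighbourhood.
  have hnull : ∑ b, (pd c (low G K b) y * K y b + low G K b y * pd c (fun z ↦ K z b) y) = 0 := by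
    rw [← pd_const c 0 y, ← pd_congr (f := fun z ↦ ∑ a, low G K a z * K z a) c
      (by filter_upwards [h.isOpen.mem_nhds hy] with z hz using h.null z hz), pd_sum]
    · exact Finset.sum_congr rfl fun b _ ↦ (pd_mul c (smooth_diff (h.smooth_low hy b))
        (smooth_diff (h.smooth_K y hy b))).symm
    · exact fun j ↦ smooth_diff ((h.smooth_low hy j).mul (h.smooth_K y hy j))
  have hW : ∀ b, ∑ a, low G K a y * chris G a b c y = ∑ e, K y e * ((1 / 2) *
      (pd b (fun z ↦ G z e c) y + pd c (fun z ↦ G z e b) y - pd e (fun z ↦ G z b c) y)) := by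
    intro b
    simp only [← lower_chris (h.det y hy), low, Finset.mul_sum, Finset.sum_mul]
    rw [Finset.sum_comm]
    exact Finset.sum_congr rfl fun e _ ↦ Finset.sum_congr rfl fun a _ ↦ by rw [h.symm y a e]; ring
  have hsym : ∀ i j, (fun z ↦ G z i j) = fun z ↦ G z j i :=
    fun i j ↦ funext fun z ↦ h.symm z i j
  have e1 : ∑ b, K y b * ∑ a, low G K a y * chris G a b c y
      = (1 / 2) * ∑ b, ∑ e, K y b * K y e * pd c (fun z ↦ G z b e) y := by
    -- Contracting with the symmetric `K^b K^e` cancels two of the three metric derivatives in the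
    -- lowered Christoffel symbol.
    have hsw : ∑ b, ∑ e, K y b * K y e * pd b (fun z ↦ G z e c) y
        = ∑ b, ∑ e, K y b * K y e * pd e (fun z ↦ G z b c) y := by
      rw [Finset.sum_comm]
      exact Finset.sum_congr rfl fun e _ ↦ Finset.sum_congr rfl fun a _ ↦ by ring
    have : ∑ b, K y b * ∑ a, low G K a y * chris G a b c y
      = (1 / 2) * (∑ b, ∑ e, K y b * K y e * pd b (fun z ↦ G z e c) y
        + ∑ b, ∑ e, K y b * K y e * pd c (fun z ↦ G z b e) y
        - ∑ b, ∑ e, K y b * K y e * pd e (fun z ↦ G z b c) y) := by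
      simp only [hW, Finset.mul_sum, ← Finset.sum_add_distrib, ← Finset.sum_sub_distrib]
      exact Finset.sum_congr rfl fun b _ ↦ Finset.sum_congr rfl fun e _ ↦ by
        rw [hsym e b]; ring
    rw [this, hsw]; ring
  have e2 : ∑ b, K y b * pd c (low G K b) y
      = ∑ b, ∑ e, K y b * K y e * pd c (fun z ↦ G z b e) y
        + ∑ e, low G K e y * pd c (fun z ↦ K z e) y := by
    simp only [hpd, mul_add, Finset.sum_add_distrib, Finset.mul_sum, low, Finset.sum_mul]
    congr 1
    · exact Finset.sum_congr rfl fun b _ ↦ Finset.sum_congr rfl fun e _ ↦ by ring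
    · rw [Finset.sum_comm]
      exact Finset.sum_congr rfl fun b _ ↦ Finset.sum_congr rfl fun e _ ↦ by
        rw [h.symm y e b]; ring
  rw [Finset.sum_add_distrib] at hnull
  have e3 : ∑ b, pd c (low G K b) y * K y b = ∑ b, K y b * pd c (low G K b) y :=
    Finset.sum_congr rfl fun b _ ↦ mul_comm _ _
  rw [e1]
  linarith

theorem lower_cov (h : IsLocalKS G K U) (hy : y ∈ U) (b e : Fin n) :
    ∑ a, G y e a * cov G K b a y
      = pd b (low G K e) y - ∑ a, low G K a y * chris G a b e y := by
  have hsym : ∀ i j, (fun z ↦ G z i j) = fun z ↦ G z j i :=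
    fun i j ↦ funext fun z ↦ h.symm z i j
  have hpd : pd b (low G K e) y
      = ∑ a, (pd b (fun z ↦ G z e a) y * K y a + G y e a * pd b (fun z ↦ K z a) y) := by
    rw [show low G K e = fun z ↦ ∑ j, G z e j * K z j from rfl, pd_sum]
    · exact Finset.sum_congr rfl fun a _ ↦ pd_mul b (smooth_diff (h.smooth_G y hy e a))
        (smooth_diff (h.smooth_K y hy a))
    · exact fun j ↦ smooth_diff ((h.smooth_G y hy e j).mul (h.smooth_K y hy j))
  have hW : ∑ a, low G K a y * chris G a b e y = ∑ c, K y c * ((1 / 2) *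
      (pd b (fun z ↦ G z c e) y + pd e (fun z ↦ G z c b) y - pd c (fun z ↦ G z b e) y)) := by
    simp only [← lower_chris (h.det y hy), low, Finset.mul_sum, Finset.sum_mul]
    rw [Finset.sum_comm]
    exact Finset.sum_congr rfl fun e _ ↦ Finset.sum_congr rfl fun a _ ↦ by rw [h.symm y a e]; ring
  have hL : ∑ a, G y e a * ∑ c, chris G a b c y * K y c = ∑ c, K y c * ((1 / 2) *
      (pd b (fun z ↦ G z e c) y + pd c (fun z ↦ G z e b) y - pd e (fun z ↦ G z b c) y)) := by
    simp only [← lower_chris (h.det y hy), Finset.mul_sum]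
    rw [Finset.sum_comm]
    exact Finset.sum_congr rfl fun e _ ↦ Finset.sum_congr rfl fun a _ ↦ by ring
  simp only [cov, mul_add, Finset.sum_add_distrib, hL, hW, hpd]
  rw [add_comm, add_sub_right_comm, ← Finset.sum_sub_distrib]
  congr 1
  exact Finset.sum_congr rfl fun c _ ↦ by rw [hsym c e, hsym c b, hsym e b]; ring

/-- `k_b k^b_{;a} = 0`. -/
theorem sum_low_cov (h : IsLocalKS G K U) (hy : y ∈ U) (b : Fin n) :
    ∑ a, low G K a y * cov G K b a y = 0 := by
  have : ∑ a, low G K a y * cov G K b a y = ∑ e, K y e * ∑ a, G y e a * cov G K b a y := by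
    simp only [low, Finset.mul_sum, Finset.sum_mul]
    rw [Finset.sum_comm]
    exact Finset.sum_congr rfl fun e _ ↦ Finset.sum_congr rfl fun a _ ↦ by rw [h.symm y a e]; ring
  rw [this]
  simp only [h.lower_cov hy, mul_sub, Finset.sum_sub_distrib]
  rw [← h.sum_K_low_chris hy b]
  simp only [chris_symm h.symm _ b]
  ring

/-- Since `K^b κ_{b;e} = 0`, the acceleration covector `K^b κ_{e;b}` may be antisymmetrized. The
result involves only `dκ`, without Christoffel symbols, which makes a change of chart easy. -/
theorem lower_geodesic (h : IsLocalKS G K U) (hy : y ∈ U) (e : Fin n) :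
    ∑ a, G y e a * ∑ b, K y b * cov G K b a y = ∑ b, K y b * dcov (low G K) b e y := by
  have : ∑ a, G y e a * ∑ b, K y b * cov G K b a y
      = ∑ b, K y b * ∑ a, G y e a * cov G K b a y := by
    simp only [Finset.mul_sum]
    rw [Finset.sum_comm]
    exact Finset.sum_congr rfl fun e _ ↦ Finset.sum_congr rfl fun a _ ↦ by ring
  rw [this]
  simp only [h.lower_cov hy, dcov, mul_sub, Finset.sum_sub_distrib, h.sum_K_low_chris hy e]

theorem geodesic_iff (h : IsLocalKS G K U) (hy : y ∈ U) (c : ℝ) :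
    (∀ a, ∑ b, K y b * cov G K b a y = c * K y a) ↔
      ∀ e, ∑ b, K y b * dcov (low G K) b e y = c * low G K e y := by
  have hl : ∀ e, c * low G K e y = ∑ a, G y e a * (c * K y a) := fun e ↦ by
    simp only [low, Finset.mul_sum]
    exact Finset.sum_congr rfl fun a _ ↦ by ring
  simp only [← h.lower_geodesic hy, hl]
  exact ⟨fun H e ↦ by simp only [H], fun H ↦ eq_of_sum_mul_eq (h.det y hy) H⟩

end IsLocalKS

end LocalCalculus

/-! ### Difference of the connections and of the Ricci tensors -/

section LocalDifference

variable {n : ℕ}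

/-- Components of the vector obtained by raising the index of the covector `v` with the
Kerr-Schild metric. -/
def ksUp (G : EuclideanSpace ℝ (Fin n) → Matrix (Fin n) (Fin n) ℝ)
    (K : EuclideanSpace ℝ (Fin n) → Fin n → ℝ) (f : EuclideanSpace ℝ (Fin n) → ℝ)
    (v : Fin n → EuclideanSpace ℝ (Fin n) → ℝ) (a : Fin n) (y : EuclideanSpace ℝ (Fin n)) : ℝ :=
  ∑ d, (ksMat G K f y)⁻¹ a d * v d y

/-- The symmetric tensor `k_b ∂_c f + k_c ∂_b f + f (k_{b;c} + k_{c;b})`. -/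
def ksSym (G : EuclideanSpace ℝ (Fin n) → Matrix (Fin n) (Fin n) ℝ)
    (K : EuclideanSpace ℝ (Fin n) → Fin n → ℝ) (f : EuclideanSpace ℝ (Fin n) → ℝ)
    (b c : Fin n) (y : EuclideanSpace ℝ (Fin n)) : ℝ :=
  pd b f y * low G K c y + pd c f y * low G K b y + f y * (pd b (low G K c) y + pd c (low G K b) y
    - 2 * ∑ a, low G K a y * chris G a b c y)

/-- The difference of the Christoffel symbols of the Kerr-Schild metric and the background. -/
def ksDiff (G : EuclideanSpace ℝ (Fin n) → Matrix (Fin n) (Fin n) ℝ)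
    (K : EuclideanSpace ℝ (Fin n) → Fin n → ℝ) (f : EuclideanSpace ℝ (Fin n) → ℝ)
    (a b c : Fin n) (y : EuclideanSpace ℝ (Fin n)) : ℝ :=
  (1 / 2) * (K y a * ksSym G K f b c y
    - ksUp G K f (fun d ↦ pd d f) a y * (low G K b y * low G K c y)
    + f y * (ksUp G K f (dcov (low G K) b) a y * low G K c y
      + ksUp G K f (dcov (low G K) c) a y * low G K b y))

variable {G : EuclideanSpace ℝ (Fin n) → Matrix (Fin n) (Fin n) ℝ}
  {K : EuclideanSpace ℝ (Fin n) → Fin n → ℝ} {U : Set (EuclideanSpace ℝ (Fin n))}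
  {f : EuclideanSpace ℝ (Fin n) → ℝ} {y : EuclideanSpace ℝ (Fin n)}

namespace IsLocalKS

theorem sum_ksMat_ksUp (h : IsLocalKS G K U) (hy : y ∈ U)
    (v : Fin n → EuclideanSpace ℝ (Fin n) → ℝ) (e : Fin n) :
    ∑ a, ksMat G K f y e a * ksUp G K f v a y = v e y :=
  sum_mul_inv (h.det_ksMat hy) (fun d ↦ v d y) e

theorem sum_low_ksUp (h : IsLocalKS G K U) (hy : y ∈ U)
    (v : Fin n → EuclideanSpace ℝ (Fin n) → ℝ) :
    ∑ a, low G K a y * ksUp G K f v a y = ∑ d, K y d * v d y := by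
  simp only [← h.ksMat_mul_K (f := f) hy, ← h.sum_ksMat_ksUp (f := f) hy v, Finset.sum_mul,
    Finset.mul_sum]
  rw [Finset.sum_comm]
  exact Finset.sum_congr rfl fun e _ ↦ Finset.sum_congr rfl fun a _ ↦ by
    rw [h.symm_ksMat y a e]; ring

theorem ksUp_low (h : IsLocalKS G K U) (hy : y ∈ U) (a : Fin n) :
    ksUp G K f (low G K) a y = K y a := by
  simp only [ksUp, ← h.ksMat_mul_K (f := f) hy]
  exact sum_inv_mul (h.det_ksMat hy) (K y) a

/-- Lowering the upper index with the invertible full metric turns the claim into the Leibniz rule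
for `f κ_i κ_j`. Keeping `ksUp` unexpanded avoids further powers of `f`. -/
theorem chris_ksMat (h : IsLocalKS G K U) (hy : y ∈ U) (hf : ContDiffAt ℝ ∞ f y)
    (a b c : Fin n) : chris (ksMat G K f) a b c y = chris G a b c y + ksDiff G K f a b c y := by
  refine eq_of_sum_mul_eq (h.det_ksMat (f := f) hy)
    (v := fun a ↦ chris (ksMat G K f) a b c y)
    (w := fun a ↦ chris G a b c y + ksDiff G K f a b c y) (fun e ↦ ?_) a
  rw [lower_chris (h.det_ksMat hy)]
  have hpd : ∀ b i j, pd b (fun z ↦ ksMat G K f z i j) y = pd b (fun z ↦ G z i j) y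
      + (pd b f y * (low G K i y * low G K j y)
        + f y * (pd b (low G K i) y * low G K j y + low G K i y * pd b (low G K j) y)) := by
    intro b i j
    have hi := h.smooth_low hy i
    have hj := h.smooth_low hy j
    simp only [ksMat]
    rw [pd_add b (smooth_diff (h.smooth_G y hy i j)) (smooth_diff (hf.mul (hi.mul hj))),
      pd_mul b (smooth_diff hf) (smooth_diff (hi.mul hj)),
      pd_mul b (smooth_diff hi) (smooth_diff hj)]
  have hΓ : ∑ a, ksMat G K f y e a * chris G a b c y = (1 / 2) *
      (pd b (fun z ↦ G z e c) y + pd c (fun z ↦ G z e b) y - pd e (fun z ↦ G z b c) y)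
      + f y * low G K e y * ∑ a, low G K a y * chris G a b c y := by
    rw [← lower_chris (h.det y hy)]
    simp only [ksMat, Finset.mul_sum, ← Finset.sum_add_distrib]
    exact Finset.sum_congr rfl fun a _ ↦ by ring
  have hC : ∑ a, ksMat G K f y e a * ksDiff G K f a b c y = (1 / 2) *
      (low G K e y * ksSym G K f b c y - pd e f y * (low G K b y * low G K c y)
      + f y * (dcov (low G K) b e y * low G K c y + dcov (low G K) c e y * low G K b y)) := by
    rw [← h.ksMat_mul_K (f := f) hy e, ← h.sum_ksMat_ksUp (f := f) hy (fun d ↦ pd d f) e,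
      ← h.sum_ksMat_ksUp (f := f) hy (dcov (low G K) b) e,
      ← h.sum_ksMat_ksUp (f := f) hy (dcov (low G K) c) e]
    simp only [ksDiff, Finset.mul_sum, Finset.sum_mul, ← Finset.sum_add_distrib,
      ← Finset.sum_sub_distrib]
    exact Finset.sum_congr rfl fun a _ ↦ by ring
  simp only [mul_add, Finset.sum_add_distrib]
  rw [hΓ, hC]
  simp only [hpd, ksSym, dcov]
  ring

theorem ksDiff_symm (h : IsLocalKS G K U) (a b c : Fin n) :
    ksDiff G K f a b c y = ksDiff G K f a c b y := by
  have : ∀ a, chris G a b c y = chris G a c b y := fun a ↦ chris_symm h.symm a b c y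
  simp only [ksDiff, ksSym, this]
  ring

section Geodesic

variable {c₀ : ℝ}

/-- Split the symmetrized derivative of `κ` as `dκ` plus twice `∂_c κ_b`: the first part is governed
by the geodesic condition, the second cancels the Christoffel term by `sum_K_low_chris`. -/
theorem sum_K_ksSym (h : IsLocalKS G K U) (hy : y ∈ U)
    (hg : ∀ e, ∑ b, K y b * dcov (low G K) b e y = c₀ * low G K e y) (c : Fin n) :
    ∑ b, K y b * ksSym G K f b c y
      = (∑ d, K y d * pd d f y + f y * c₀) * low G K c y := by
  have e1 : ∑ b, K y b * ksSym G K f b c y = (∑ d, K y d * pd d f y) * low G K c y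
      + pd c f y * (∑ b, low G K b y * K y b)
      + f y * (∑ b, K y b * dcov (low G K) b c y + 2 * ∑ b, K y b * pd c (low G K b) y
        - 2 * ∑ b, K y b * ∑ a, low G K a y * chris G a b c y) := by
    rw [Finset.mul_sum, Finset.mul_sum, Finset.mul_sum, Finset.sum_mul, ← Finset.sum_add_distrib,
      ← Finset.sum_add_distrib, ← Finset.sum_sub_distrib, Finset.mul_sum,
      ← Finset.sum_add_distrib]
    exact Finset.sum_congr rfl fun b _ ↦ by simp only [ksSym, dcov]; ring
  rw [e1, h.sum_K_low_chris hy, h.null y hy, hg]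
  ring

theorem sum_K_ksUp_dcov (h : IsLocalKS G K U) (hy : y ∈ U)
    (hg : ∀ e, ∑ b, K y b * dcov (low G K) b e y = c₀ * low G K e y) (a : Fin n) :
    ∑ b, K y b * ksUp G K f (dcov (low G K) b) a y = c₀ * K y a := by
  rw [← h.ksUp_low (f := f) hy a]
  simp only [ksUp, Finset.mul_sum]
  rw [Finset.sum_comm]
  refine Finset.sum_congr rfl fun d _ ↦ ?_
  rw [mul_left_comm, ← hg, Finset.mul_sum]
  exact Finset.sum_congr rfl fun a _ ↦ by ring

theorem sum_low_ksUp_dcov (h : IsLocalKS G K U) (hy : y ∈ U)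
    (hg : ∀ e, ∑ b, K y b * dcov (low G K) b e y = c₀ * low G K e y) (b : Fin n) :
    ∑ a, low G K a y * ksUp G K f (dcov (low G K) b) a y = -(c₀ * low G K b y) := by
  rw [h.sum_low_ksUp hy, ← hg, ← Finset.sum_neg_distrib]
  exact Finset.sum_congr rfl fun a _ ↦ by simp only [dcov]; ring

/-- Full contraction of the symmetric inverse metric with the antisymmetric `dκ`. -/
theorem trace_ksUp_dcov (h : IsLocalKS G K U) :
    ∑ a, ksUp G K f (dcov (low G K) a) a y = 0 := by
  have hT : (ksMat G K f y).transpose = ksMat G K f y := by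
    ext i j; exact h.symm_ksMat y j i
  have hi : ∀ a d, (ksMat G K f y)⁻¹ a d = (ksMat G K f y)⁻¹ d a := fun a d ↦ by
    conv_lhs => rw [← hT, ← Matrix.transpose_nonsing_inv, Matrix.transpose_apply]
  have : ∑ a, ksUp G K f (dcov (low G K) a) a y = -∑ a, ksUp G K f (dcov (low G K) a) a y := by
    conv_lhs => simp only [ksUp]
    rw [Finset.sum_comm, ← Finset.sum_neg_distrib]
    simp only [ksUp, ← Finset.sum_neg_distrib]
    exact Finset.sum_congr rfl fun e _ ↦ Finset.sum_congr rfl fun a _ ↦ by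
      rw [hi]; simp only [dcov]; ring
  linarith

/-- Terms containing `κ_b` die by nullity; each survivor is a multiple of `K^a κ_c`. -/
theorem sum_K_ksDiff (h : IsLocalKS G K U) (hy : y ∈ U)
    (hg : ∀ e, ∑ b, K y b * dcov (low G K) b e y = c₀ * low G K e y) (a c : Fin n) :
    ∑ b, K y b * ksDiff G K f a b c y
      = (1 / 2) * (∑ d, K y d * pd d f y + 2 * f y * c₀) * K y a * low G K c y := by
  have e1 : ∑ b, K y b * ksDiff G K f a b c y = (1 / 2) * (K y a * ∑ b, K y b * ksSym G K f b c y
      - ksUp G K f (fun d ↦ pd d f) a y * low G K c y * (∑ b, low G K b y * K y b)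
      + f y * ((∑ b, K y b * ksUp G K f (dcov (low G K) b) a y) * low G K c y
        + ksUp G K f (dcov (low G K) c) a y * (∑ b, low G K b y * K y b))) := by
    simp only [ksDiff, Finset.mul_sum, Finset.sum_mul, ← Finset.sum_add_distrib,
      ← Finset.sum_sub_distrib]
    exact Finset.sum_congr rfl fun b _ ↦ by ring
  rw [e1, h.sum_K_ksSym hy hg, h.null y hy, h.sum_K_ksUp_dcov hy hg]
  ring

/-- This reflects that a null rank one perturbation preserves the determinant, hence the volume
density. Here it follows from cancellation of the `K(f)` and `c₀` terms among the contractions. -/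
theorem trace_ksDiff (h : IsLocalKS G K U) (hy : y ∈ U)
    (hg : ∀ e, ∑ b, K y b * dcov (low G K) b e y = c₀ * low G K e y) (c : Fin n) :
    ∑ a, ksDiff G K f a a c y = 0 := by
  have e1 : ∑ a, ksDiff G K f a a c y = (1 / 2) * (∑ b, K y b * ksSym G K f b c y
      - (∑ a, low G K a y * ksUp G K f (fun d ↦ pd d f) a y) * low G K c y
      + f y * ((∑ a, ksUp G K f (dcov (low G K) a) a y) * low G K c y
        + ∑ a, low G K a y * ksUp G K f (dcov (low G K) c) a y)) := by
    simp only [ksDiff, Finset.mul_sum, Finset.sum_mul, ← Finset.sum_add_distrib,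
      ← Finset.sum_sub_distrib]
    exact Finset.sum_congr rfl fun b _ ↦ by ring
  rw [e1, h.sum_K_ksSym hy hg, h.sum_low_ksUp hy, h.trace_ksUp_dcov, h.sum_low_ksUp_dcov hy hg]
  ring

/-- Against `∇_a K^b`, a factor `K^a` gives `c₀ K^b` and a factor `κ_b` gives zero; what is left
carries `κ_c`. -/
theorem sum_ksDiff_cov (h : IsLocalKS G K U) (hy : y ∈ U)
    (hg : ∀ e, ∑ b, K y b * dcov (low G K) b e y = c₀ * low G K e y) :
    ∃ τ, ∀ c, ∑ a, ∑ b, ksDiff G K f a b c y * cov G K a b y = τ * low G K c y := by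
  refine ⟨(1 / 2) * (c₀ * (∑ d, K y d * pd d f y + f y * c₀)
    + f y * ∑ a, ∑ b, ksUp G K f (dcov (low G K) b) a y * cov G K a b y), fun c ↦ ?_⟩
  have e1 : ∑ a, ∑ b, ksDiff G K f a b c y * cov G K a b y
      = (1 / 2) * (∑ b, (∑ a, K y a * cov G K a b y) * ksSym G K f b c y
      - (∑ a, ksUp G K f (fun d ↦ pd d f) a y * ∑ b, low G K b y * cov G K a b y) * low G K c y
      + f y * ((∑ a, ∑ b, ksUp G K f (dcov (low G K) b) a y * cov G K a b y) * low G K c y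
        + ∑ a, ksUp G K f (dcov (low G K) c) a y * ∑ b, low G K b y * cov G K a b y)) := by
    have : ∑ b, (∑ a, K y a * cov G K a b y) * ksSym G K f b c y
        = ∑ a, ∑ b, K y a * cov G K a b y * ksSym G K f b c y := by
      simp only [Finset.sum_mul]
      exact Finset.sum_comm
    rw [this]
    simp only [ksDiff, Finset.mul_sum, Finset.sum_mul, ← Finset.sum_add_distrib,
      ← Finset.sum_sub_distrib]
    exact Finset.sum_congr rfl fun a _ ↦ Finset.sum_congr rfl fun b _ ↦ by ring
  have e2 : ∑ b, (∑ a, K y a * cov G K a b y) * ksSym G K f b c y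
      = c₀ * ∑ b, K y b * ksSym G K f b c y := by
    simp only [(h.geodesic_iff hy c₀).2 hg, Finset.mul_sum]
    exact Finset.sum_congr rfl fun b _ ↦ by ring
  rw [e1, e2, h.sum_K_ksSym hy hg]
  simp only [h.sum_low_cov hy]
  simp
  ring

end Geodesic

theorem smooth_ksDiff (h : IsLocalKS G K U) (hf : ∀ y ∈ U, ContDiffAt ℝ ∞ f y) (hy : y ∈ U)
    (a b c : Fin n) : ContDiffAt ℝ ∞ (ksDiff G K f a b c) y := by
  have := (contDiffAt_chris (h.smooth_ksMat hy (hf y hy)) (h.det_ksMat hy) a b c).sub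
    (contDiffAt_chris (h.smooth_G y hy) (h.det y hy) a b c)
  refine this.congr_of_eventuallyEq ?_
  filter_upwards [h.isOpen.mem_nhds hy] with z hz
  simp [h.chris_ksMat hz (hf z hz)]

/-- The Palatini expansion, exact in the difference tensor and written with partial derivatives. -/
theorem ric_ksMat (h : IsLocalKS G K U) (hf : ∀ y ∈ U, ContDiffAt ℝ ∞ f y) (hy : y ∈ U)
    (b c : Fin n) : ric (ksMat G K f) b c y = ric G b c y
      + (∑ a, (pd a (ksDiff G K f a b c) y - pd c (ksDiff G K f a b a) y)
        + ∑ a, ∑ d, (chris G a a d y * ksDiff G K f d b c y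
          + ksDiff G K f a a d y * (chris G d b c y + ksDiff G K f d b c y)
          - (chris G a c d y * ksDiff G K f d b a y + ksDiff G K f a c d y * chris G d b a y
            + ksDiff G K f a c d y * ksDiff G K f d b a y))) := by
  have hpd : ∀ i a b c, pd i (chris (ksMat G K f) a b c) y
      = pd i (chris G a b c) y + pd i (ksDiff G K f a b c) y := by
    intro i a b c
    rw [← pd_add i (smooth_diff (contDiffAt_chris (h.smooth_G y hy) (h.det y hy) a b c))
      (smooth_diff (h.smooth_ksDiff hf hy a b c))]
    refine pd_congr i ?_
    filter_upwards [h.isOpen.mem_nhds hy] with z hz using h.chris_ksMat hz (hf z hz) a b c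
  simp only [ric, hpd, h.chris_ksMat hy (hf y hy)]
  rw [add_add_add_comm]
  simp only [← Finset.sum_add_distrib]
  refine Finset.sum_congr rfl fun a _ ↦ congrArg₂ _ (by ring) ?_
  exact Finset.sum_congr rfl fun b _ ↦ by ring

/-- For geodesic `k` the covectors `R_{bc} k^b` of the Kerr-Schild metric and of the background
differ by a multiple of `k_c`. -/
theorem sum_K_ric_ksMat (h : IsLocalKS G K U) (hf : ∀ y ∈ U, ContDiffAt ℝ ∞ f y)
    {lam : EuclideanSpace ℝ (Fin n) → ℝ}
    (hg : ∀ y ∈ U, ∀ e, ∑ b, K y b * dcov (low G K) b e y = lam y * low G K e y)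
    (hy : y ∈ U) (hlam : DifferentiableAt ℝ lam y) :
    ∃ σ, ∀ c, ∑ b, K y b * ric (ksMat G K f) b c y
      = ∑ b, K y b * ric G b c y + σ * low G K c y := by
  obtain ⟨τ, hτ⟩ := h.sum_ksDiff_cov (f := f) hy (hg y hy)
  let θ : EuclideanSpace ℝ (Fin n) → ℝ := fun z ↦
    (1 / 2) * (∑ d, K z d * pd d f z + 2 * f z * lam z)
  have hKd : ∀ i, DifferentiableAt ℝ (fun z ↦ K z i) y := fun i ↦ smooth_diff (h.smooth_K y hy i)
  have hθ : DifferentiableAt ℝ θ y := by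
    refine (DifferentiableAt.add ?_ (((smooth_diff (hf y hy)).const_mul 2).mul hlam)).const_mul _
    exact DifferentiableAt.fun_sum fun d _ ↦
      (hKd d).mul (smooth_diff (contDiffAt_pd d (hf y hy)))
  have hKC : ∀ z ∈ U, ∀ a c, ∑ b, K z b * ksDiff G K f a b c z = θ z * K z a * low G K c z :=
    fun z hz a c ↦ h.sum_K_ksDiff hz (hg z hz) a c
  have hKC' : ∀ a c, ∑ b, K y b * ksDiff G K f a c b y = θ y * K y a * low G K c y := by
    intro a c
    rw [← hKC y hy a c]
    exact Finset.sum_congr rfl fun b _ ↦ by rw [h.ksDiff_symm]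
  have hCd : ∀ a b c, DifferentiableAt ℝ (ksDiff G K f a b c) y :=
    fun a b c ↦ smooth_diff (h.smooth_ksDiff hf hy a b c)
  have htr : ∀ b c, ∑ a, pd c (ksDiff G K f a b a) y = 0 := by
    intro b c
    rw [← pd_sum c fun a ↦ hCd a b a, ← pd_const c 0 y]
    refine pd_congr c ?_
    filter_upwards [h.isOpen.mem_nhds hy] with z hz
    rw [← h.trace_ksDiff (f := f) hz (hg z hz) b]
    exact Finset.sum_congr rfl fun a _ ↦ by rw [h.ksDiff_symm]
  -- Differentiating the contraction `K^b C^a_{bc} = θ K^a κ_c` moves the derivative from `C` to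
  -- `K`, `θ` and `κ`.
  have hpdC : ∀ a c, ∑ b, K y b * pd a (ksDiff G K f a b c) y
      = pd a (fun z ↦ θ z * K z a) y * low G K c y + θ y * K y a * pd a (low G K c) y
        - ∑ b, ksDiff G K f a b c y * pd a (fun z ↦ K z b) y := by
    intro a c
    rw [← pd_mul (f := fun z ↦ θ z * K z a) a (hθ.mul (hKd a)) (smooth_diff (h.smooth_low hy c)),
      ← pd_congr a (f := fun z ↦ ∑ b, K z b * ksDiff G K f a b c z)
        (by filter_upwards [h.isOpen.mem_nhds hy] with z hz using hKC z hz a c),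
      pd_sum (f := fun b z ↦ K z b * ksDiff G K f a b c z) a
        (fun b ↦ (hKd b).mul (hCd a b c)), ← Finset.sum_sub_distrib]
    refine Finset.sum_congr rfl fun b _ ↦ ?_
    rw [pd_mul a (hKd b) (hCd a b c)]
    ring
  -- The factor is `div(θ K) + θ λ - τ`, with the background divergence.
  refine ⟨∑ a, pd a (fun z ↦ θ z * K z a) y + θ y * lam y
    + ∑ a, ∑ d, chris G a a d y * (θ y * K y d) - τ, fun c ↦ ?_⟩
  have s1 : ∑ b, K y b * ∑ a, (pd a (ksDiff G K f a b c) y - pd c (ksDiff G K f a b a) y)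
      = (∑ a, pd a (fun z ↦ θ z * K z a) y) * low G K c y
        + θ y * ∑ a, K y a * pd a (low G K c) y
        - ∑ a, ∑ b, ksDiff G K f a b c y * pd a (fun z ↦ K z b) y := by
    simp only [Finset.sum_sub_distrib, htr, sub_zero]
    have : ∑ b, K y b * ∑ a, pd a (ksDiff G K f a b c) y
        = ∑ a, ∑ b, K y b * pd a (ksDiff G K f a b c) y := by
      simp only [Finset.mul_sum]; exact Finset.sum_comm
    rw [this]
    simp only [hpdC, Finset.sum_sub_distrib, Finset.sum_add_distrib, Finset.sum_mul,
      Finset.mul_sum, mul_assoc]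
  have hsw : ∀ (A : Fin n → Fin n → ℝ) (B : Fin n → Fin n → Fin n → ℝ),
      ∑ b, K y b * ∑ a, ∑ d, A a d * B a d b = ∑ a, ∑ d, A a d * ∑ b, K y b * B a d b := by
    intro A B
    simp only [Finset.mul_sum]
    rw [Finset.sum_comm]
    refine Finset.sum_congr rfl fun a _ ↦ ?_
    rw [Finset.sum_comm]
    exact Finset.sum_congr rfl fun d _ ↦ Finset.sum_congr rfl fun b _ ↦ by ring
  have s2 : ∑ b, K y b * ∑ a, ∑ d, chris G a a d y * ksDiff G K f d b c y
      = (∑ a, ∑ d, chris G a a d y * (θ y * K y d)) * low G K c y := by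
    rw [hsw]
    simp only [hKC y hy, Finset.sum_mul, mul_assoc]
  have s3 : ∀ b, ∑ a, ∑ d, ksDiff G K f a a d y * (chris G d b c y + ksDiff G K f d b c y)
      = 0 := by
    intro b
    rw [Finset.sum_comm]
    simp only [← Finset.sum_mul, h.trace_ksDiff hy (hg y hy), zero_mul, Finset.sum_const_zero]
  have s4 : ∑ b, K y b * ∑ a, ∑ d, chris G a c d y * ksDiff G K f d b a y
      = θ y * ∑ d, K y d * ∑ a, low G K a y * chris G a d c y := by
    rw [hsw]
    simp only [hKC y hy, Finset.mul_sum]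
    rw [Finset.sum_comm]
    exact Finset.sum_congr rfl fun d _ ↦ Finset.sum_congr rfl fun a _ ↦ by
      rw [chris_symm h.symm a c d]; ring
  have s5 : ∑ b, K y b * ∑ a, ∑ d, ksDiff G K f a c d y * chris G d b a y
      = ∑ a, ∑ b, ksDiff G K f a b c y * ∑ d, chris G b a d y * K y d := by
    rw [hsw]
    refine Finset.sum_congr rfl fun a _ ↦ Finset.sum_congr rfl fun d _ ↦ ?_
    rw [h.ksDiff_symm a c d]
    congr 1
    exact Finset.sum_congr rfl fun b _ ↦ by rw [chris_symm h.symm, mul_comm]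
  -- Applying the contraction of `C` with `K` twice leaves the factor `κ(K) = 0`, so the quadratic
  -- term drops.
  have s6 : ∑ b, K y b * ∑ a, ∑ d, ksDiff G K f a c d y * ksDiff G K f d b a y = 0 := by
    rw [hsw]
    simp only [hKC y hy]
    have : ∑ a, ∑ d, ksDiff G K f a c d y * (θ y * K y d * low G K a y)
        = ∑ a, (θ y * low G K a y) * ∑ d, K y d * ksDiff G K f a c d y := by
      simp only [Finset.mul_sum]
      exact Finset.sum_congr rfl fun a _ ↦ Finset.sum_congr rfl fun d _ ↦ by ring
    rw [this]
    simp only [hKC']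
    have : ∑ a, θ y * low G K a y * (θ y * K y a * low G K c y)
        = θ y * θ y * low G K c y * ∑ a, low G K a y * K y a := by
      rw [Finset.mul_sum]
      exact Finset.sum_congr rfl fun a _ ↦ by ring
    rw [this, h.null y hy, mul_zero]
  -- The leftover of `hpdC` and the cross term `s5` combine into `C^a_{bc} ∇_a K^b = τ κ_c`.
  have s7 : ∑ a, ∑ b, ksDiff G K f a b c y * cov G K a b y
      = ∑ a, ∑ b, ksDiff G K f a b c y * pd a (fun z ↦ K z b) y
        + ∑ a, ∑ b, ksDiff G K f a b c y * ∑ d, chris G b a d y * K y d := by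
    simp only [cov, mul_add, Finset.sum_add_distrib]
  -- The geodesic equation, with `K^b ∂_c κ_b` rewritten through Christoffel symbols so as to match
  -- `s1` minus `s4`.
  have s8 := hg y hy c
  simp only [dcov, mul_sub, Finset.sum_sub_distrib] at s8
  rw [← h.sum_K_low_chris hy c] at s8
  simp only [h.ric_ksMat hf hy, mul_add, Finset.sum_add_distrib, Finset.sum_sub_distrib, mul_sub]
    at s1 s2 s3 s4 s5 s6 ⊢
  have s3' : ∑ b, K y b * ∑ a, ∑ d, ksDiff G K f a a d y * chris G d b c y
      + ∑ b, K y b * ∑ a, ∑ d, ksDiff G K f a a d y * ksDiff G K f d b c y = 0 := by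
    rw [← Finset.sum_add_distrib]
    exact Finset.sum_eq_zero fun b _ ↦ by rw [← mul_add, s3 b, mul_zero]
  rw [hτ] at s7
  linear_combination s1 + s2 + s3' - s4 - s5 - s6 + s7 + θ y * s8

end IsLocalKS

end LocalDifference

/-! ### Dependence on the parameters: convergence of the Ricci tensor -/

section Families

variable {n : ℕ} {P : Type*}

/-- A family of functions differentiable at `y` whose values and first derivatives at `y` converge
along `l`. -/
def TameFamily (l : Filter P) (y : EuclideanSpace ℝ (Fin n))
    (u : P → EuclideanSpace ℝ (Fin n) → ℝ) : Prop :=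
  (∀ μ, DifferentiableAt ℝ (u μ) y) ∧ (∃ a, Tendsto (fun μ ↦ u μ y) l (𝓝 a)) ∧
    ∀ i, ∃ a, Tendsto (fun μ ↦ pd i (u μ) y) l (𝓝 a)

/-- A family of functions differentiable at `y` whose values and first derivatives at `y` tend to
zero along `l`. -/
def VanishingFamily (l : Filter P) (y : EuclideanSpace ℝ (Fin n))
    (u : P → EuclideanSpace ℝ (Fin n) → ℝ) : Prop :=
  (∀ μ, DifferentiableAt ℝ (u μ) y) ∧ Tendsto (fun μ ↦ u μ y) l (𝓝 0) ∧
    ∀ i, Tendsto (fun μ ↦ pd i (u μ) y) l (𝓝 0)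

variable {l : Filter P} {y : EuclideanSpace ℝ (Fin n)} {u v : P → EuclideanSpace ℝ (Fin n) → ℝ}

theorem VanishingFamily.tame (hu : VanishingFamily l y u) : TameFamily l y u :=
  ⟨hu.1, ⟨0, hu.2.1⟩, fun i ↦ ⟨0, hu.2.2 i⟩⟩

theorem tameFamily_const {w : EuclideanSpace ℝ (Fin n) → ℝ} (hw : DifferentiableAt ℝ w y) :
    TameFamily l y (fun _ ↦ w) :=
  ⟨fun _ ↦ hw, ⟨_, tendsto_const_nhds⟩, fun _ ↦ ⟨_, tendsto_const_nhds⟩⟩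

theorem VanishingFamily.congr (hu : VanishingFamily l y u) (h : ∀ μ, v μ =ᶠ[𝓝 y] u μ) :
    VanishingFamily l y v := by
  refine ⟨fun μ ↦ (hu.1 μ).congr_of_eventuallyEq (h μ), ?_, fun i ↦ ?_⟩
  · simpa only [(h _).eq_of_nhds] using hu.2.1
  · simpa only [pd_congr i (h _)] using hu.2.2 i

theorem TameFamily.congr (hu : TameFamily l y u) (h : ∀ μ, v μ =ᶠ[𝓝 y] u μ) :
    TameFamily l y v := by
  refine ⟨fun μ ↦ (hu.1 μ).congr_of_eventuallyEq (h μ), ?_, fun i ↦ ?_⟩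
  · simpa only [(h _).eq_of_nhds] using hu.2.1
  · simpa only [pd_congr i (h _)] using hu.2.2 i

theorem TameFamily.mul (hu : TameFamily l y u) (hv : TameFamily l y v) :
    TameFamily l y (fun μ z ↦ u μ z * v μ z) := by
  obtain ⟨hu1, ⟨a, ha⟩, hu3⟩ := hu
  obtain ⟨hv1, ⟨b, hb⟩, hv3⟩ := hv
  refine ⟨fun μ ↦ (hu1 μ).mul (hv1 μ), ⟨_, ha.mul hb⟩, fun i ↦ ?_⟩
  obtain ⟨a', ha'⟩ := hu3 i
  obtain ⟨b', hb'⟩ := hv3 i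
  simp only [pd_mul i (hu1 _) (hv1 _)]
  exact ⟨_, (ha'.mul hb).add (ha.mul hb')⟩

/-- Vanishing families form an ideal among the tame ones, so one vanishing factor per term suffices.
-/
theorem VanishingFamily.mul_tame (hu : VanishingFamily l y u) (hv : TameFamily l y v) :
    VanishingFamily l y (fun μ z ↦ u μ z * v μ z) := by
  obtain ⟨hu1, ha, hu3⟩ := hu
  obtain ⟨hv1, ⟨b, hb⟩, hv3⟩ := hv
  refine ⟨fun μ ↦ (hu1 μ).mul (hv1 μ), by simpa using ha.mul hb, fun i ↦ ?_⟩
  obtain ⟨b', hb'⟩ := hv3 i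
  simp only [pd_mul i (hu1 _) (hv1 _)]
  simpa using ((hu3 i).mul hb).add (ha.mul hb')

theorem TameFamily.mul_vanishing (hu : TameFamily l y u) (hv : VanishingFamily l y v) :
    VanishingFamily l y (fun μ z ↦ u μ z * v μ z) := by
  simpa only [mul_comm] using hv.mul_tame hu

theorem VanishingFamily.add (hu : VanishingFamily l y u) (hv : VanishingFamily l y v) :
    VanishingFamily l y (fun μ z ↦ u μ z + v μ z) := by
  refine ⟨fun μ ↦ (hu.1 μ).add (hv.1 μ), by simpa using hu.2.1.add hv.2.1, fun i ↦ ?_⟩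
  simp only [pd_add i (hu.1 _) (hv.1 _)]
  simpa using (hu.2.2 i).add (hv.2.2 i)

theorem TameFamily.add (hu : TameFamily l y u) (hv : TameFamily l y v) :
    TameFamily l y (fun μ z ↦ u μ z + v μ z) := by
  obtain ⟨hu1, ⟨a, ha⟩, hu3⟩ := hu
  obtain ⟨hv1, ⟨b, hb⟩, hv3⟩ := hv
  refine ⟨fun μ ↦ (hu1 μ).add (hv1 μ), ⟨_, ha.add hb⟩, fun i ↦ ?_⟩
  obtain ⟨a', ha'⟩ := hu3 i
  obtain ⟨b', hb'⟩ := hv3 i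
  simp only [pd_add i (hu1 _) (hv1 _)]
  exact ⟨_, ha'.add hb'⟩

theorem VanishingFamily.neg (hu : VanishingFamily l y u) :
    VanishingFamily l y (fun μ z ↦ -u μ z) := by
  simpa using (tameFamily_const (l := l) (differentiableAt_const (-1 : ℝ))).mul_vanishing hu

theorem TameFamily.neg (hu : TameFamily l y u) : TameFamily l y (fun μ z ↦ -u μ z) := by
  simpa using (tameFamily_const (l := l) (differentiableAt_const (-1 : ℝ))).mul hu

theorem VanishingFamily.sum {ι : Type*} {s : Finset ι}
    {u : ι → P → EuclideanSpace ℝ (Fin n) → ℝ} (hu : ∀ j, VanishingFamily l y (u j)) :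
    VanishingFamily l y (fun μ z ↦ ∑ j ∈ s, u j μ z) := by
  refine ⟨fun μ ↦ DifferentiableAt.fun_sum fun j _ ↦ (hu j).1 μ, ?_, fun i ↦ ?_⟩
  · simpa using tendsto_finsetSum s fun j _ ↦ (hu j).2.1
  · simp only [pd_sum i (fun j ↦ (hu j).1 _)]
    simpa using tendsto_finsetSum s fun j _ ↦ (hu j).2.2 i

theorem TameFamily.sum {ι : Type*} {s : Finset ι}
    {u : ι → P → EuclideanSpace ℝ (Fin n) → ℝ} (hu : ∀ j, TameFamily l y (u j)) :
    TameFamily l y (fun μ z ↦ ∑ j ∈ s, u j μ z) := by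
  choose hu1 hu2 hu3 using hu
  choose a ha using hu2
  choose b hb using hu3
  refine ⟨fun μ ↦ DifferentiableAt.fun_sum fun j _ ↦ hu1 j μ,
    ⟨_, tendsto_finsetSum s fun j _ ↦ ha j⟩, fun i ↦ ⟨∑ j ∈ s, b j i, ?_⟩⟩
  simp only [pd_sum i (fun j ↦ hu1 j _)]
  exact tendsto_finsetSum s fun j _ ↦ hb j i

variable {G : EuclideanSpace ℝ (Fin n) → Matrix (Fin n) (Fin n) ℝ}
  {K : EuclideanSpace ℝ (Fin n) → Fin n → ℝ} {U : Set (EuclideanSpace ℝ (Fin n))}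
  {f : P → EuclideanSpace ℝ (Fin n) → ℝ}

namespace IsLocalKS

theorem tame_inv (h : IsLocalKS G K U) (hy : y ∈ U) (hf : VanishingFamily l y f) (a d : Fin n) :
    TameFamily l y (fun μ z ↦ (ksMat G K (f μ) z)⁻¹ a d) := by
  have hK : ∀ i, TameFamily l y (fun _ z ↦ K z i) :=
    fun i ↦ tameFamily_const (smooth_diff (h.smooth_K y hy i))
  refine ((tameFamily_const (smooth_diff (contDiffAt_inv (h.smooth_G y hy) (h.det y hy) a d))).add
    (hf.tame.mul ((hK a).mul (hK d))).neg).congr fun μ ↦ ?_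
  filter_upwards [h.isOpen.mem_nhds hy] with z hz
  rw [h.inv_ksMat hz]
  ring

/-- Each term of `C` has a factor `f` or `∂f`, all others being tame. Vanishing of the family `∂f`
includes the second derivatives of `f`. -/
theorem vanishing_ksDiff (h : IsLocalKS G K U) (hy : y ∈ U) (hf : VanishingFamily l y f)
    (hf' : ∀ d, VanishingFamily l y (fun μ ↦ pd d (f μ))) (a b c : Fin n) :
    VanishingFamily l y (fun μ ↦ ksDiff G K (f μ) a b c) := by
  have hK : ∀ i, TameFamily l y (fun _ z ↦ K z i) :=
    fun i ↦ tameFamily_const (smooth_diff (h.smooth_K y hy i))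
  have hκ : ∀ i, TameFamily l y (fun _ ↦ low G K i) :=
    fun i ↦ tameFamily_const (smooth_diff (h.smooth_low hy i))
  have hdκ : ∀ i j, TameFamily l y (fun _ ↦ pd i (low G K j)) :=
    fun i j ↦ tameFamily_const (smooth_diff (contDiffAt_pd i (h.smooth_low hy j)))
  have hW : TameFamily l y (fun _ z ↦ -2 * ∑ a, low G K a z * chris G a b c z) :=
    tameFamily_const ((DifferentiableAt.fun_sum fun a _ ↦ (smooth_diff (h.smooth_low hy a)).mul
      (smooth_diff (contDiffAt_chris (h.smooth_G y hy) (h.det y hy) a b c))).const_mul _)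
  have hX : ∀ i, TameFamily l y (fun μ ↦ ksUp G K (f μ) (dcov (low G K) i) a) := fun i ↦
    TameFamily.sum fun d ↦ (h.tame_inv hy hf a d).mul
      (tameFamily_const (smooth_diff (h.smooth_dcov hy i d)))
  have hF : VanishingFamily l y (fun μ ↦ ksUp G K (f μ) (fun d ↦ pd d (f μ)) a) :=
    VanishingFamily.sum fun d ↦ (h.tame_inv hy hf a d).mul_vanishing (hf' d)
  have hM : VanishingFamily l y (fun μ ↦ ksSym G K (f μ) b c) := by
    refine ((((hf' b).mul_tame (hκ c)).add ((hf' c).mul_tame (hκ b))).add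
      (hf.mul_tame (((hdκ b c).add (hdκ c b)).add hW))).congr fun μ ↦ .of_forall fun z ↦ ?_
    simp only [ksSym]; ring
  refine ((tameFamily_const (differentiableAt_const (1 / 2 : ℝ))).mul_vanishing
    ((((hK a).mul_vanishing hM).add (hF.mul_tame ((hκ b).mul (hκ c))).neg).add
      (hf.mul_tame (((hX b).mul (hκ c)).add ((hX c).mul (hκ b)))))).congr
    fun μ ↦ .of_forall fun z ↦ ?_
  simp only [ksDiff]; ring

theorem tendsto_ric_ksMat (h : IsLocalKS G K U) (hy : y ∈ U)
    (hs : ∀ μ, ∀ y ∈ U, ContDiffAt ℝ ∞ (f μ) y) (hf : VanishingFamily l y f)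
    (hf' : ∀ d, VanishingFamily l y (fun μ ↦ pd d (f μ))) (b c : Fin n) :
    Tendsto (fun μ ↦ ric (ksMat G K (f μ)) b c y) l (𝓝 (ric G b c y)) := by
  have hC := h.vanishing_ksDiff hy hf hf'
  have hv : ∀ a b c, Tendsto (fun μ ↦ ksDiff G K (f μ) a b c y) l (𝓝 0) :=
    fun a b c ↦ (hC a b c).2.1
  have hd : ∀ i a b c, Tendsto (fun μ ↦ pd i (ksDiff G K (f μ) a b c) y) l (𝓝 0) :=
    fun i a b c ↦ (hC a b c).2.2 i
  simp only [h.ric_ksMat (hs _) hy]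
  have h1 := tendsto_finsetSum Finset.univ fun a _ ↦ (hd a a b c).sub (hd c a b a)
  have h2 := tendsto_finsetSum Finset.univ fun a _ ↦ tendsto_finsetSum Finset.univ fun d _ ↦
    (((hv d b c).const_mul (chris G a a d y)).add
      ((hv a a d).mul ((hv d b c).const_add (chris G d b c y)))).sub
    ((((hv d b a).const_mul (chris G a c d y)).add ((hv a c d).mul_const (chris G d b a y))).add
      ((hv a c d).mul (hv d b a)))
  simpa using (h1.add h2).const_add (ric G b c y)

end IsLocalKS

end Families

/-! ### Coordinate changes and the exterior derivative -/

section Transition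

variable {n : ℕ}

theorem pd_apply {ψ : EuclideanSpace ℝ (Fin n) → EuclideanSpace ℝ (Fin n)}
    {y : EuclideanSpace ℝ (Fin n)} (hψ : DifferentiableAt ℝ ψ y) (b c : Fin n) :
    pd b (fun z ↦ ψ z c) y = fderiv ℝ ψ y (EuclideanSpace.single b 1) c := by
  have := ((EuclideanSpace.proj (𝕜 := ℝ) c).hasFDerivAt.comp y hψ.hasFDerivAt).fderiv
  rw [pd, show (fun z ↦ ψ z c) = (EuclideanSpace.proj (𝕜 := ℝ) c) ∘ ψ from rfl, this]
  rfl

theorem eq_sum_single (w : EuclideanSpace ℝ (Fin n)) :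
    w = ∑ c, w c • EuclideanSpace.single c (1 : ℝ) := by
  ext i
  simp [Pi.single_apply]

theorem pd_comp {ψ : EuclideanSpace ℝ (Fin n) → EuclideanSpace ℝ (Fin n)}
    {u : EuclideanSpace ℝ (Fin n) → ℝ} {y : EuclideanSpace ℝ (Fin n)}
    (hψ : DifferentiableAt ℝ ψ y) (hu : DifferentiableAt ℝ u (ψ y)) (b : Fin n) :
    pd b (fun z ↦ u (ψ z)) y = ∑ c, pd c u (ψ y) * pd b (fun z ↦ ψ z c) y := by
  have h1 : pd b (fun z ↦ u (ψ z)) y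
      = fderiv ℝ u (ψ y) (fderiv ℝ ψ y (EuclideanSpace.single b 1)) := by
    rw [pd, show (fun z ↦ u (ψ z)) = u ∘ ψ from rfl, fderiv_comp y hu hψ]
    rfl
  rw [h1, eq_sum_single (fderiv ℝ ψ y (EuclideanSpace.single b 1))]
  simp only [pd_apply hψ, map_sum, map_smul, smul_eq_mul]
  exact Finset.sum_congr rfl fun c _ ↦ mul_comm _ _

theorem pd_pd_eq {u : EuclideanSpace ℝ (Fin n) → ℝ} {y : EuclideanSpace ℝ (Fin n)}
    (hu : ContDiffAt ℝ ∞ u y) (i j : Fin n) : pd i (pd j u) y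
      = fderiv ℝ (fderiv ℝ u) y (EuclideanSpace.single i 1) (EuclideanSpace.single j 1) := by
  have hd : DifferentiableAt ℝ (fderiv ℝ u) y :=
    (hu.fderiv_right (m := ∞) le_rfl).differentiableAt (by simp)
  rw [pd, show pd j u = fun z ↦ fderiv ℝ u z (EuclideanSpace.single j 1) from rfl,
    fderiv_clm_apply hd (differentiableAt_const _)]
  simp

theorem pd_pd_comm {u : EuclideanSpace ℝ (Fin n) → ℝ} {y : EuclideanSpace ℝ (Fin n)}
    (hu : ContDiffAt ℝ ∞ u y) (b d : Fin n) : pd b (pd d u) y = pd d (pd b u) y := by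
  rw [pd_pd_eq hu, pd_pd_eq hu]
  exact (hu.isSymmSndFDerivAt (by simpa using ENat.LEInfty.out)) _ _

/-- The contraction of a vector with the exterior derivative of a covector field is invariant
under changes of coordinates. -/
theorem sum_mul_dcov_transition {ψ : EuclideanSpace ℝ (Fin n) → EuclideanSpace ℝ (Fin n)}
    {y : EuclideanSpace ℝ (Fin n)} (hψ : ∀ a, ContDiffAt ℝ ∞ (fun z ↦ ψ z a) y)
    {κ κ' : Fin n → EuclideanSpace ℝ (Fin n) → ℝ} (hκ' : ∀ a, DifferentiableAt ℝ (κ' a) (ψ y))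
    (hκ : ∀ i, κ i =ᶠ[𝓝 y] fun z ↦ ∑ a, κ' a (ψ z) * pd i (fun z ↦ ψ z a) z)
    {X X' : Fin n → ℝ} (hX : ∀ a, X' a = ∑ i, pd i (fun z ↦ ψ z a) y * X i) (d : Fin n) :
    ∑ b, X b * dcov κ b d y
      = ∑ a, (∑ c, X' c * dcov κ' c a (ψ y)) * pd d (fun z ↦ ψ z a) y := by
  have hψd : DifferentiableAt ℝ ψ y := by
    rw [differentiableAt_euclidean]
    exact fun a ↦ smooth_diff (hψ a)
  have hc : ∀ a, DifferentiableAt ℝ (fun z ↦ κ' a (ψ z)) y := fun a ↦ (hκ' a).comp y hψd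
  have hpd : ∀ b d, pd b (κ d) y = ∑ a, ((∑ c, pd c (κ' a) (ψ y) * pd b (fun z ↦ ψ z c) y)
      * pd d (fun z ↦ ψ z a) y + κ' a (ψ y) * pd b (pd d (fun z ↦ ψ z a)) y) := by
    intro b d
    rw [pd_congr b (hκ d), pd_sum (f := fun a z ↦ κ' a (ψ z) * pd d (fun z ↦ ψ z a) z) b
      fun a ↦ (hc a).mul (smooth_diff (contDiffAt_pd d (hψ a)))]
    refine Finset.sum_congr rfl fun a _ ↦ ?_
    rw [pd_mul b (hc a) (smooth_diff (contDiffAt_pd d (hψ a))), pd_comp hψd (hκ' a)]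
  -- Antisymmetrization removes the second derivatives of `ψ`.
  have hdc : ∀ b, dcov κ b d y = ∑ a, ∑ c, dcov κ' c a (ψ y) * pd b (fun z ↦ ψ z c) y
      * pd d (fun z ↦ ψ z a) y := by
    intro b
    have hsw : ∑ a, ∑ c, pd c (κ' a) (ψ y) * pd d (fun z ↦ ψ z c) y * pd b (fun z ↦ ψ z a) y
        = ∑ a, ∑ c, pd a (κ' c) (ψ y) * pd b (fun z ↦ ψ z c) y * pd d (fun z ↦ ψ z a) y := by
      rw [Finset.sum_comm]
      exact Finset.sum_congr rfl fun a _ ↦ Finset.sum_congr rfl fun c _ ↦ by ring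
    simp only [dcov, hpd, Finset.sum_add_distrib, sub_mul, Finset.sum_sub_distrib, Finset.sum_mul,
      hsw, fun a ↦ pd_pd_comm (hψ a) b d]
    ring
  simp only [hdc, hX, Finset.mul_sum, Finset.sum_mul]
  rw [Finset.sum_comm]
  refine Finset.sum_congr rfl fun a _ ↦ ?_
  rw [Finset.sum_comm]
  exact Finset.sum_congr rfl fun c _ ↦ Finset.sum_congr rfl fun b _ ↦ by ring

end Transition

/-! ### From the manifold to coordinates -/

section Charts

variable {n : ℕ} {M : Type*} [TopologicalSpace M]
  [ChartedSpace (EuclideanSpace ℝ (Fin n)) M]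

theorem symm_mem_source {p : M} {y : EuclideanSpace ℝ (Fin n)}
    (hy : y ∈ (extChartAt (𝓡 n) p).target) :
    (extChartAt (𝓡 n) p).symm y ∈ (chartAt (EuclideanSpace ℝ (Fin n)) p).source := by
  simpa only [extChartAt_source] using (extChartAt (𝓡 n) p).map_target hy

theorem metric_sum_basis {g : BilinField n M} {x : M}
    {b : Module.Basis (Fin n) ℝ (TangentSpace (𝓡 n) x)}
    (hb : ∀ i j, g x (b i) (b j) = if i = j then (if (i : ℕ) = 0 then -1 else 1) else 0)
    (i : Fin n) (v : TangentSpace (𝓡 n) x) :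
    g x (b i) v = (if (i : ℕ) = 0 then -1 else 1) * b.repr v i := by
  conv_lhs => rw [← b.sum_repr v, map_sum]
  simp [hb, mul_comm]

/-- Without time component, `g(v, v)` is a sum of squares of the spatial components. -/
theorem IsLorentzMetric.eq_zero_of_null {g : BilinField n M} {x : M}
    (hs : ∀ v w, g x v w = g x w v) (i₀ : Fin n)
    (hi₀ : (i₀ : ℕ) = 0) {b : Module.Basis (Fin n) ℝ (TangentSpace (𝓡 n) x)}
    (hb : ∀ i j, g x (b i) (b j) = if i = j then (if (i : ℕ) = 0 then -1 else 1) else 0)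
    {v : TangentSpace (𝓡 n) x} (hv : g x v v = 0) (h0 : b.repr v i₀ = 0) : v = 0 := by
  have h : g x v v = ∑ i, b.repr v i * g x (b i) v := by
    conv_lhs => enter [2]; rw [← b.sum_repr v]
    rw [map_sum]
    exact Finset.sum_congr rfl fun i _ ↦ by rw [(g x v).map_smul, hs v]; rfl
  have h2 : ∀ i, b.repr v i * g x (b i) v = b.repr v i ^ 2 := by
    intro i
    rw [metric_sum_basis hb]
    by_cases hi : (i : ℕ) = 0
    · have : i = i₀ := Fin.ext (hi.trans hi₀.symm)
      rw [this, h0]; ring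
    · rw [if_neg hi]; ring
  rw [hv] at h
  simp only [h2] at h
  refine b.ext_elem fun i ↦ ?_
  have := (Finset.sum_eq_zero_iff_of_nonneg fun i _ ↦ sq_nonneg (b.repr v i)).1 h.symm i
    (Finset.mem_univ i)
  simpa using this

variable [IsManifold (𝓡 n) ∞ M]

/-- The components of a vector field in the chart around `p`, as functions on coordinate space. -/
def vecCoord (X : VecField n M) (p : M) (y : EuclideanSpace ℝ (Fin n)) (a : Fin n) : ℝ :=
  comp p ((extChartAt (𝓡 n) p).symm y) (X ((extChartAt (𝓡 n) p).symm y)) a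

theorem ricci_eq (g : BilinField n M) (p : M) (v w : TangentSpace (𝓡 n) p) :
    ricci g p v w = ∑ b, ∑ c, comp p p v b * comp p p w c *
      ric (metricMat g p) b c (extChartAt (𝓡 n) p p) := rfl

theorem vecCoord_self (X : VecField n M) (p : M) (a : Fin n) :
    vecCoord X p (extChartAt (𝓡 n) p p) a = comp p p (X p) a :=
  congrArg (fun q ↦ comp p q (X q) a) (extChartAt_to_inv (I := 𝓡 n) p)

theorem covDerivComp_eq (g : BilinField n M) (X : VecField n M) (p : M) (a : Fin n) :
    covDerivComp g X p (X p) a = ∑ b, vecCoord X p (extChartAt (𝓡 n) p p) b *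
      cov (metricMat g p) (vecCoord X p) b a (extChartAt (𝓡 n) p p) := by
  simp only [cov, vecCoord_self]
  rfl

theorem sum_comp_coordVec {p q : M} (hq : q ∈ (chartAt (EuclideanSpace ℝ (Fin n)) p).source)
    (v : TangentSpace (𝓡 n) q) : ∑ a, comp p q v a • coordVec p q a = v := by
  have h := (trivializationAt (EuclideanSpace ℝ (Fin n)) (TangentSpace (𝓡 n)) p
    ).symmL_continuousLinearMapAt
    (R := ℝ) (b := q) hq v
  rw [eq_sum_single ((trivializationAt (EuclideanSpace ℝ (Fin n)) (TangentSpace (𝓡 n)) p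
    ).continuousLinearMapAt ℝ q v), map_sum] at h
  simp only [map_smul] at h
  exact h

theorem comp_coordVec {p q : M} (hq : q ∈ (chartAt (EuclideanSpace ℝ (Fin n)) p).source)
    (i a : Fin n) : comp p q (coordVec p q i) a = if a = i then 1 else 0 := by
  have h := (trivializationAt (EuclideanSpace ℝ (Fin n)) (TangentSpace (𝓡 n)) p
    ).continuousLinearMapAt_symmL
    (R := ℝ) (b := q) hq (EuclideanSpace.single i 1)
  rw [comp, coordVec, h]
  simp

theorem coordVec_of_notMem {p q : M}
    (hq : q ∉ (chartAt (EuclideanSpace ℝ (Fin n)) p).source) (i : Fin n) :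
    coordVec p q i = 0 := by
  exact Trivialization.symmL_apply_of_notMem _ hq _

theorem comp_sum_smul {p q : M} {ι : Type*} (s : Finset ι) (c : ι → ℝ)
    (v : ι → TangentSpace (𝓡 n) q) (a : Fin n) :
    comp p q (∑ i ∈ s, c i • v i) a = ∑ i ∈ s, c i * comp p q (v i) a := by
  simp [comp, map_sum]

theorem comp_add {p q : M} (v w : TangentSpace (𝓡 n) q) (a : Fin n) :
    comp p q (v + w) a = comp p q v a + comp p q w a := by
  simp [comp]

theorem comp_smul {p q : M} (c : ℝ) (v : TangentSpace (𝓡 n) q) (a : Fin n) :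
    comp p q (c • v) a = c * comp p q v a := by
  simp [comp]

theorem metric_eq_sum_right (g : BilinField n M) {p q : M}
    (hq : q ∈ (chartAt (EuclideanSpace ℝ (Fin n)) p).source) (v w : TangentSpace (𝓡 n) q) :
    g q v w = ∑ a, comp p q w a * g q v (coordVec p q a) := by
  conv_lhs => rw [← sum_comp_coordVec hq w, map_sum]
  exact Finset.sum_congr rfl fun a _ ↦ (g q v).map_smul _ _

theorem metric_eq_sum_left (g : BilinField n M) {p q : M}
    (hq : q ∈ (chartAt (EuclideanSpace ℝ (Fin n)) p).source) (v w : TangentSpace (𝓡 n) q) :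
    g q v w = ∑ a, comp p q v a * g q (coordVec p q a) w := by
  conv_lhs => rw [← sum_comp_coordVec hq v]
  rw [map_sum, sum_apply]
  exact Finset.sum_congr rfl fun a _ ↦ by rw [(g q).map_smul]; rfl

theorem low_metricMat (g : BilinField n M) (X : VecField n M) {p q : M} (i : Fin n)
    {y : EuclideanSpace ℝ (Fin n)} (hy : (extChartAt (𝓡 n) p).symm y = q) :
    low (metricMat g p) (vecCoord X p) i y = g q (coordVec p q i) (X q) := by
  subst hy
  by_cases hq : (extChartAt (𝓡 n) p).symm y ∈ (chartAt (EuclideanSpace ℝ (Fin n)) p).source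
  · rw [metric_eq_sum_right g hq]
    exact Finset.sum_congr rfl fun a _ ↦ mul_comm _ _
  -- Outside the chart `coordVec` has the default value zero and both sides vanish, so no
  -- restriction on `y` is needed.
  · have h0 : ∀ v, g _ (coordVec p ((extChartAt (𝓡 n) p).symm y) i) v = 0 := fun v ↦ by
      rw [coordVec_of_notMem hq, map_zero]; rfl
    simp only [low, metricMat, h0, zero_mul, Finset.sum_const_zero]

theorem contDiffAt_comp_symm {u : M → ℝ} {p : M} {y : EuclideanSpace ℝ (Fin n)}
    (hy : y ∈ (extChartAt (𝓡 n) p).target)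
    (hu : ContMDiffAt (𝓡 n) 𝓘(ℝ) ∞ u ((extChartAt (𝓡 n) p).symm y)) :
    ContDiffAt ℝ ∞ (fun z ↦ u ((extChartAt (𝓡 n) p).symm z)) y := by
  rw [← contMDiffAt_iff_contDiffAt]
  have h := (contMDiffOn_extChartAt_symm (I := 𝓡 n) (n := ∞) p).contMDiffAt
    ((isOpen_extChartAt_target (I := 𝓡 n) p).mem_nhds hy)
  exact hu.comp y h

theorem IsSmoothVecField.contDiffAt_vecCoord {X : VecField n M} (hX : IsSmoothVecField X) {p : M}
    {y : EuclideanSpace ℝ (Fin n)} (hy : y ∈ (extChartAt (𝓡 n) p).target) (a : Fin n) :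
    ContDiffAt ℝ ∞ (fun z ↦ vecCoord X p z a) y := by
  refine contDiffAt_comp_symm (u := fun q ↦ comp p q (X q) a) hy ?_
  have hq := symm_mem_source hy
  have h := ((trivializationAt (EuclideanSpace ℝ (Fin n)) (TangentSpace (𝓡 n)) p
    ).contMDiffAt_section_iff
    (IB := 𝓡 n) (n := ∞) (s := X) hq).1 (hX _)
  have h2 := (EuclideanSpace.proj (𝕜 := ℝ) a).contMDiff.contMDiffAt.comp _ h
  refine h2.congr_of_eventuallyEq ?_
  filter_upwards [(chartAt (EuclideanSpace ℝ (Fin n)) p).open_source.mem_nhds hq] with q' hq'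
  rw [comp, Trivialization.continuousLinearMapAt_apply_of_mem ℝ _ hq']
  rfl

theorem contMDiffAt_coordVec {p q : M}
    (hq : q ∈ (chartAt (EuclideanSpace ℝ (Fin n)) p).source) (i : Fin n) :
    ContMDiffAt (𝓡 n) ((𝓡 n).prod 𝓘(ℝ, EuclideanSpace ℝ (Fin n))) ∞
      (fun q ↦ TotalSpace.mk' (EuclideanSpace ℝ (Fin n)) (E := TangentSpace (𝓡 n)) q
        (coordVec p q i)) q := by
  rw [(trivializationAt (EuclideanSpace ℝ (Fin n)) (TangentSpace (𝓡 n)) p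
    ).contMDiffAt_section_iff
    (IB := 𝓡 n) (n := ∞) (s := fun q ↦ coordVec p q i) hq]
  refine (contMDiffAt_const (c := EuclideanSpace.single i (1 : ℝ))).congr_of_eventuallyEq ?_
  filter_upwards [(chartAt (EuclideanSpace ℝ (Fin n)) p).open_source.mem_nhds hq] with q' hq'
  rw [coordVec, Trivialization.symmL_apply _ hq']
  exact congrArg Prod.snd (Trivialization.apply_mk_symm _ hq' _)

theorem IsLorentzMetric.contDiffAt_metricMat {g : BilinField n M} (hg : IsLorentzMetric g) {p : M}
    {y : EuclideanSpace ℝ (Fin n)} (hy : y ∈ (extChartAt (𝓡 n) p).target) (i j : Fin n) :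
    ContDiffAt ℝ ∞ (fun z ↦ metricMat g p z i j) y := by
  refine contDiffAt_comp_symm (u := fun q ↦ g q (coordVec p q i) (coordVec p q j)) hy ?_
  have hq := symm_mem_source hy
  have h := ContMDiffAt.clm_bundle_apply₂ (F₁ := EuclideanSpace ℝ (Fin n))
    (F₂ := EuclideanSpace ℝ (Fin n)) (F₃ := ℝ) (E₃ := Bundle.Trivial M ℝ)
    (hg.1 ((extChartAt (𝓡 n) p).symm y)) (contMDiffAt_coordVec hq i) (contMDiffAt_coordVec hq j)
  exact (contMDiffAt_totalSpace.1 h).2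

theorem IsLorentzMetric.eq_zero_of_forall {g : BilinField n M} (hg : IsLorentzMetric g) {x : M}
    {v : TangentSpace (𝓡 n) x} (h : ∀ w, g x w v = 0) : v = 0 := by
  obtain ⟨b, hb⟩ := hg.2.2 x
  refine b.ext_elem fun i ↦ ?_
  have := metric_sum_basis hb i v
  rw [h] at this
  split_ifs at this <;> simpa using this.symm

theorem IsLorentzMetric.isUnit_det {g : BilinField n M} (hg : IsLorentzMetric g) {p : M}
    {y : EuclideanSpace ℝ (Fin n)} (hy : y ∈ (extChartAt (𝓡 n) p).target) :
    IsUnit (metricMat g p y).det := by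
  have hq := symm_mem_source hy
  rw [isUnit_iff_ne_zero]
  intro h0
  obtain ⟨v, hv, hv0⟩ := Matrix.exists_mulVec_eq_zero_iff.2 h0
  have hc : ∀ a, comp p _ (∑ j, v j • coordVec p ((extChartAt (𝓡 n) p).symm y) j) a = v a := by
    intro a
    rw [comp_sum_smul]
    simp only [comp_coordVec hq, mul_ite, mul_one, mul_zero, Finset.sum_ite_eq, Finset.mem_univ,
      if_true]
  have hX : ∑ j, v j • coordVec p ((extChartAt (𝓡 n) p).symm y) j = 0 := by
    refine hg.eq_zero_of_forall fun w ↦ ?_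
    rw [metric_eq_sum_left g hq]
    refine Finset.sum_eq_zero fun i _ ↦ ?_
    rw [metric_eq_sum_right g hq]
    simp only [hc]
    have := congrFun hv0 i
    simp only [Matrix.mulVec, dotProduct, mul_comm (metricMat g p y i _)] at this
    exact mul_eq_zero_of_right _ this
  refine hv (funext fun a ↦ ?_)
  rw [← hc a, hX, comp, map_zero]
  rfl

theorem IsLorentzMetric.isLocalKS {g : BilinField n M} (hg : IsLorentzMetric g) {X : VecField n M}
    (hX : IsSmoothVecField X) (h0 : ∀ x, g x (X x) (X x) = 0) (p : M) :
    IsLocalKS (metricMat g p) (vecCoord X p) (extChartAt (𝓡 n) p).target where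
  isOpen := isOpen_extChartAt_target p
  smooth_G y hy i j := hg.contDiffAt_metricMat hy i j
  symm y i j := hg.2.1 _ _ _
  det y hy := hg.isUnit_det hy
  smooth_K y hy i := hX.contDiffAt_vecCoord hy i
  null y hy := by
    have h := h0 ((extChartAt (𝓡 n) p).symm y)
    rw [metric_eq_sum_left g (symm_mem_source hy)] at h
    rw [← h]
    exact Finset.sum_congr rfl fun a _ ↦ by rw [low_metricMat g X a rfl, mul_comm]; rfl

/-- Identifies the tangent bundle's coordinate change with the Jacobian of the transition map. Both
trivializations pass through the preferred chart at the point itself, and the cocycle identity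
removes it. -/
theorem comp_coordVec_eq_pd {p q : M} {z : EuclideanSpace ℝ (Fin n)}
    (hz : z ∈ (extChartAt (𝓡 n) p).target)
    (hq : (extChartAt (𝓡 n) p).symm z ∈ (extChartAt (𝓡 n) q).source) (i a : Fin n) :
    comp q ((extChartAt (𝓡 n) p).symm z) (coordVec p ((extChartAt (𝓡 n) p).symm z) i) a
      = pd i (fun z ↦ (extChartAt (𝓡 n) q ((extChartAt (𝓡 n) p).symm z)) a) z := by
  have hp := (extChartAt (𝓡 n) p).map_target hz
  have hd := hasFDerivWithinAt_tangentCoordChange (I := 𝓡 n) ⟨hp, hq⟩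
  rw [(extChartAt (𝓡 n) p).right_inv hz] at hd
  have hd' := hd.hasFDerivAt (by simp)
  rw [pd_apply (ψ := fun z ↦ extChartAt (𝓡 n) q ((extChartAt (𝓡 n) p).symm z))
    hd'.differentiableAt]
  have hfd : fderiv ℝ (fun z ↦ extChartAt (𝓡 n) q ((extChartAt (𝓡 n) p).symm z)) z
    = tangentCoordChange (𝓡 n) p q ((extChartAt (𝓡 n) p).symm z) := hd'.fderiv
  rw [hfd, comp, coordVec, TangentBundle.continuousLinearMapAt_trivializationAt_eq_core
    (by simpa using hq), TangentBundle.symmL_trivializationAt_eq_core (by simpa using hp)]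
  exact congrArg (fun v : EuclideanSpace ℝ (Fin n) ↦ v a) (tangentCoordChange_comp (I := 𝓡 n)
    ⟨⟨hp, mem_extChartAt_source _⟩, hq⟩)

theorem contDiffAt_transition {p q : M} {z : EuclideanSpace ℝ (Fin n)}
    (hz : z ∈ (extChartAt (𝓡 n) p).target)
    (hq : (extChartAt (𝓡 n) p).symm z ∈ (extChartAt (𝓡 n) q).source) (a : Fin n) :
    ContDiffAt ℝ ∞ (fun z ↦ (extChartAt (𝓡 n) q ((extChartAt (𝓡 n) p).symm z)) a) z := by
  refine contDiffAt_comp_symm (u := fun x ↦ extChartAt (𝓡 n) q x a) hz ?_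
  have h := contMDiffAt_extChartAt' (I := 𝓡 n) (n := ∞) (x := q) (by simpa using hq)
  exact (EuclideanSpace.proj (𝕜 := ℝ) a).contMDiff.contMDiffAt.comp _ h

/-- The geodesic condition in a fixed chart, at all points of its domain. -/
theorem IsGeodesic.exists_dcov {g : BilinField n M} (hg : IsLorentzMetric g) {k : VecField n M}
    (hk : IsSmoothVecField k) (h0 : ∀ x, g x (k x) (k x) = 0) (hgeo : IsGeodesic g k) (p : M)
    {y : EuclideanSpace ℝ (Fin n)} (hy : y ∈ (extChartAt (𝓡 n) p).target) :
    ∃ c, ∀ e, ∑ b, vecCoord k p y b * dcov (low (metricMat g p) (vecCoord k p)) b e y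
      = c * low (metricMat g p) (vecCoord k p) e y := by
  -- `IsGeodesic` speaks at each point only of the chart centred there. It is used at `q` in that
  -- chart, in its `dκ` form, and then pulled back to the chart around `p`.
  obtain ⟨q, hq⟩ : ∃ q, q = (extChartAt (𝓡 n) p).symm y := ⟨_, rfl⟩
  have hyq : (extChartAt (𝓡 n) p).symm y ∈ (extChartAt (𝓡 n) q).source := by
    rw [← hq]; exact mem_extChartAt_source q
  have hψy : extChartAt (𝓡 n) q ((extChartAt (𝓡 n) p).symm y) = extChartAt (𝓡 n) q q := by rw [← hq]
  have hKS := hg.isLocalKS hk h0 q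
  have hmem : extChartAt (𝓡 n) q q ∈ (extChartAt (𝓡 n) q).target := mem_extChartAt_target q
  obtain ⟨c, hc⟩ := hgeo q
  simp only [covDerivComp_eq, ← vecCoord_self] at hc
  have hc' := (hKS.geodesic_iff hmem c).1 hc
  have hκ : ∀ i, low (metricMat g p) (vecCoord k p) i =ᶠ[𝓝 y] fun z ↦
      ∑ a, low (metricMat g q) (vecCoord k q) a (extChartAt (𝓡 n) q ((extChartAt (𝓡 n) p).symm z))
        * pd i (fun z ↦ (extChartAt (𝓡 n) q ((extChartAt (𝓡 n) p).symm z)) a) z := by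
    intro i
    have hnhds : ∀ᶠ z in 𝓝 y, (extChartAt (𝓡 n) p).symm z ∈ (extChartAt (𝓡 n) q).source :=
      (continuousAt_extChartAt_symm'' hy).eventually ((isOpen_extChartAt_source q).mem_nhds hyq)
    filter_upwards [(isOpen_extChartAt_target (I := 𝓡 n) p).mem_nhds hy, hnhds] with z hz hzq
    have hz' : (extChartAt (𝓡 n) p).symm z
        ∈ (chartAt (EuclideanSpace ℝ (Fin n)) q).source := by simpa using hzq
    rw [low_metricMat g k i rfl, metric_eq_sum_left g hz']
    exact Finset.sum_congr rfl fun a _ ↦ by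
      rw [low_metricMat g k a ((extChartAt (𝓡 n) q).left_inv hzq), comp_coordVec_eq_pd hz hzq,
        mul_comm]
  have hX : ∀ a, vecCoord k q (extChartAt (𝓡 n) q q) a
      = ∑ i, pd i (fun z ↦ (extChartAt (𝓡 n) q ((extChartAt (𝓡 n) p).symm z)) a) y
        * vecCoord k p y i := by
    intro a
    rw [vecCoord_self]
    simp only [← comp_coordVec_eq_pd hy hyq, vecCoord]
    rw [← hq]
    have hpq : q ∈ (chartAt (EuclideanSpace ℝ (Fin n)) p).source := hq ▸ symm_mem_source hy
    conv_lhs => rw [← sum_comp_coordVec hpq (k q), comp_sum_smul]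
    exact Finset.sum_congr rfl fun a _ ↦ mul_comm _ _
  refine ⟨c, fun e ↦ ?_⟩
  rw [sum_mul_dcov_transition (X := vecCoord k p y) (X' := vecCoord k q (extChartAt (𝓡 n) q q))
    (fun a ↦ contDiffAt_transition hy hyq a)
    (fun a ↦ by rw [hψy]; exact smooth_diff (hKS.smooth_low hmem a)) hκ hX,
    (hκ e).eq_of_nhds, Finset.mul_sum]
  simp only [hψy, hc', mul_assoc]

end Charts

/-! ### Null frames, aligned directions and the background limit -/

section Frames

variable {n : ℕ} {M : Type*} [TopologicalSpace M]
  [ChartedSpace (EuclideanSpace ℝ (Fin n)) M] [IsManifold (𝓡 n) ∞ M]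

/-- In a Lorentzian metric, orthogonal null vectors are proportional. -/
theorem IsLorentzMetric.exists_smul_of_null {g : BilinField n M} (hg : IsLorentzMetric g)
    (hn : 0 < n) {x : M} {k l : TangentSpace (𝓡 n) x} (hk0 : k ≠ 0) (hk : g x k k = 0)
    (hl : g x l l = 0) (hkl : g x k l = 0) : ∃ c : ℝ, l = c • k := by
  obtain ⟨b, hb⟩ := hg.2.2 x
  let i₀ : Fin n := ⟨0, hn⟩
  have hk1 : b.repr k i₀ ≠ 0 := fun h ↦ hk0 (eq_zero_of_null (hg.2.1 x) i₀ rfl hb hk h)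
  -- This multiple of `k` cancels the time component of `l`; by orthogonality the difference is
  -- still null.
  refine ⟨b.repr l i₀ / b.repr k i₀, sub_eq_zero.1 (eq_zero_of_null (hg.2.1 x) i₀ rfl hb ?_ ?_)⟩
  · simp [hl, hk, hkl, hg.2.1 x l k]
  · simp [hk1]

namespace GKSSpacetime

variable {P : Type*} [TopologicalSpace P] (S : GKSSpacetime n M P)

theorem g_apply (μ : P) (x : M) (v w : TangentSpace (𝓡 n) x) : S.g μ x v w
    = S.gbar x v w - 2 * S.H μ x * (S.gbar x (S.k x) v * S.gbar x (S.k x) w) := by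
  simp [GKSSpacetime.g]

theorem g_k (μ : P) (x : M) (v : TangentSpace (𝓡 n) x) :
    S.g μ x (S.k x) v = S.gbar x (S.k x) v := by
  rw [g_apply, S.k_null, zero_mul, mul_zero, sub_zero]

theorem gbar_symm (x : M) (v w : TangentSpace (𝓡 n) x) : S.gbar x v w = S.gbar x w v :=
  S.isLorentz.2.1 x v w

/-- Passing to the full metric changes `r · r` by `-2H`; adding `H k` compensates, since `k · r =
1`. The vectors orthogonal to `k` do not see the perturbation. -/
theorem isNullFrame_add_smul {μ : P} {x : M} {r : TangentSpace (𝓡 n) x}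
    {m : Fin (n - 2) → TangentSpace (𝓡 n) x} (h : IsNullFrame S.gbar x (S.k x) r m) :
    IsNullFrame (S.g μ) x (S.k x) (r + S.H μ x • S.k x) m := by
  obtain ⟨h1, h2, h3, h4, h5⟩ := h
  have hm : ∀ i, S.gbar x (S.k x) (m i) = 0 := fun i ↦ by rw [S.gbar_symm, (h4 i).1]
  have hr : S.gbar x r (S.k x) = 1 := by rw [S.gbar_symm, h3]
  refine ⟨by rw [g_k, h1], ?_, ?_, fun i ↦ ⟨?_, ?_⟩, fun i j ↦ ?_⟩
  · simp only [g_apply, map_add, map_smul, add_apply, smul_apply, smul_eq_mul, h1, h2, h3, hr]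
    ring
  · simp only [g_k, map_add, map_smul, smul_eq_mul, h1, h3]
    ring
  · rw [g_apply, (h4 i).1, h1]; ring
  · simp only [g_apply, map_add, map_smul, smul_eq_mul, hm, (h4 i).1, (h4 i).2]
    ring
  · rw [g_apply, hm, h5]; ring

theorem isNullFrame_sub_smul {μ : P} {x : M} {r : TangentSpace (𝓡 n) x}
    {m : Fin (n - 2) → TangentSpace (𝓡 n) x} (h : IsNullFrame (S.g μ) x (S.k x) r m) :
    IsNullFrame S.gbar x (S.k x) (r - S.H μ x • S.k x) m := by
  obtain ⟨h1, h2, h3, h4, h5⟩ := h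
  rw [g_k] at h1 h3
  have h4' : ∀ i, S.gbar x (m i) (S.k x) = 0 := fun i ↦ by
    have := (h4 i).1
    rwa [g_apply, h1, mul_zero, mul_zero, sub_zero] at this
  have hm : ∀ i, S.gbar x (S.k x) (m i) = 0 := fun i ↦ by rw [S.gbar_symm, h4' i]
  have hr : S.gbar x r (S.k x) = 1 := by rw [S.gbar_symm, h3]
  have h2' : S.gbar x r r = 2 * S.H μ x := by
    rw [g_apply, h3] at h2; linarith
  have h4'' : ∀ i, S.gbar x (m i) r = 0 := fun i ↦ by
    have := (h4 i).2
    rwa [g_apply, hm, zero_mul, mul_zero, sub_zero] at this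
  refine ⟨h1, ?_, ?_, fun i ↦ ⟨h4' i, ?_⟩, fun i j ↦ ?_⟩
  · simp only [map_sub, map_smul, sub_apply, smul_apply, smul_eq_mul, h1, h2', h3, hr]
    ring
  · simp only [map_sub, map_smul, smul_eq_mul, h1, h3]
    ring
  · simp only [map_sub, map_smul, smul_eq_mul, h4', h4'']
    ring
  · rw [← h5 i j, g_apply, hm]; ring

/-- The function `-2 H` in the chart around `p`. -/
def ksFun (μ : P) (p : M) (y : EuclideanSpace ℝ (Fin n)) : ℝ :=
  -2 * S.H μ ((extChartAt (𝓡 n) p).symm y)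

theorem smooth_H_symm (μ : P) {p : M} {y : EuclideanSpace ℝ (Fin n)}
    (hy : y ∈ (extChartAt (𝓡 n) p).target) :
    ContDiffAt ℝ ∞ (fun z ↦ S.H μ ((extChartAt (𝓡 n) p).symm z)) y :=
  contDiffAt_comp_symm hy (S.smooth_H μ _)

theorem smooth_ksFun (μ : P) {p : M} {y : EuclideanSpace ℝ (Fin n)}
    (hy : y ∈ (extChartAt (𝓡 n) p).target) : ContDiffAt ℝ ∞ (S.ksFun μ p) y :=
  contDiffAt_const.mul (S.smooth_H_symm μ hy)

theorem metricMat_g (μ : P) (p : M) :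
    metricMat (S.g μ) p = ksMat (metricMat S.gbar p) (vecCoord S.k p) (S.ksFun μ p) := by
  funext y i j
  simp only [ksMat, low_metricMat S.gbar S.k _ rfl, metricMat, g_apply, ksFun,
    S.gbar_symm _ (S.k _)]
  ring

theorem isLocalKS (p : M) :
    IsLocalKS (metricMat S.gbar p) (vecCoord S.k p) (extChartAt (𝓡 n) p).target :=
  S.isLorentz.isLocalKS S.smooth_k S.k_null p

theorem low_self (p : M) (c : Fin n) :
    low (metricMat S.gbar p) (vecCoord S.k p) c (extChartAt (𝓡 n) p p)
      = S.gbar p (coordVec p p c) (S.k p) :=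
  low_metricMat S.gbar S.k c (extChartAt_to_inv p)

theorem exists_low_ne_zero (p : M) :
    ∃ j, low (metricMat S.gbar p) (vecCoord S.k p) j (extChartAt (𝓡 n) p p) ≠ 0 := by
  by_contra! h
  simp only [low_self] at h
  refine S.k_ne_zero p (S.isLorentz.eq_zero_of_forall fun w ↦ ?_)
  rw [metric_eq_sum_left S.gbar (mem_chart_source _ p)]
  simp [h]

/-- The covectors `R(k, ·)` of the two metrics differ by a multiple of `gbar(k, ·)`, which
annihilates `w`. -/
theorem ricci_k (hgeo : IsGeodesic S.gbar S.k) (μ : P) (x : M) {w : TangentSpace (𝓡 n) x}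
    (hw : S.gbar x w (S.k x) = 0) : ricci (S.g μ) x (S.k x) w = ricci S.gbar x (S.k x) w := by
  have hKS := S.isLocalKS x
  have hmem := mem_extChartAt_target (I := 𝓡 n) x
  have hex : ∀ y, ∃ c, y ∈ (extChartAt (𝓡 n) x).target → ∀ e,
      ∑ b, vecCoord S.k x y b * dcov (low (metricMat S.gbar x) (vecCoord S.k x)) b e y
        = c * low (metricMat S.gbar x) (vecCoord S.k x) e y := by
    intro y
    by_cases hy : y ∈ (extChartAt (𝓡 n) x).target
    · obtain ⟨c, hc⟩ := hgeo.exists_dcov S.isLorentz S.smooth_k S.k_null x hy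
      exact ⟨c, fun _ ↦ hc⟩
    · exact ⟨0, fun h ↦ absurd h hy⟩
  choose lam hlam using hex
  obtain ⟨j, hj⟩ := S.exists_low_ne_zero x
  -- `lam` was chosen pointwise; near the point it is the quotient of two smooth functions, by a
  -- component `κ_j` that does not vanish there.
  have hdiff : DifferentiableAt ℝ lam (extChartAt (𝓡 n) x x) := by
    have hl := smooth_diff (hKS.smooth_low hmem j)
    have hq : DifferentiableAt ℝ (fun z ↦ (∑ b, vecCoord S.k x z b
        * dcov (low (metricMat S.gbar x) (vecCoord S.k x)) b j z)
        * (low (metricMat S.gbar x) (vecCoord S.k x) j z)⁻¹) (extChartAt (𝓡 n) x x) :=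
      (DifferentiableAt.fun_sum fun b _ ↦ (smooth_diff (hKS.smooth_K _ hmem b)).mul
        (smooth_diff (hKS.smooth_dcov hmem b j))).mul (hl.inv hj)
    refine hq.congr_of_eventuallyEq ?_
    filter_upwards [hKS.isOpen.mem_nhds hmem, hl.continuousAt.eventually_ne hj] with z hz hz0
    rw [hlam z hz, mul_inv_cancel_right₀ hz0]
  obtain ⟨σ, hσ⟩ := hKS.sum_K_ric_ksMat (f := S.ksFun μ x) (fun y hy ↦ S.smooth_ksFun μ hy)
    hlam hmem hdiff
  have hsum : ∀ A : Fin n → Fin n → ℝ, ∑ b, ∑ c, comp x x (S.k x) b * comp x x w c * A b c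
      = ∑ c, comp x x w c * ∑ b, vecCoord S.k x (extChartAt (𝓡 n) x x) b * A b c := by
    intro A
    rw [Finset.sum_comm]
    simp only [vecCoord_self, Finset.mul_sum]
    exact Finset.sum_congr rfl fun c _ ↦ Finset.sum_congr rfl fun b _ ↦ by ring
  rw [metric_eq_sum_left S.gbar (mem_chart_source _ x)] at hw
  rw [ricci_eq, ricci_eq, hsum, hsum, metricMat_g]
  simp only [hσ, low_self, mul_add, Finset.sum_add_distrib]
  have : ∑ c, comp x x w c * (σ * S.gbar x (coordVec x x c) (S.k x)) = 0 := by
    rw [← mul_zero σ, ← hw, Finset.mul_sum]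
    exact Finset.sum_congr rfl fun c _ ↦ by ring
  rw [this, add_zero]

theorem isRicciAND_k_iff (hgeo : IsGeodesic S.gbar S.k) (μ : P) (x : M) :
    IsRicciAND S.gbar x (S.k x) ↔ IsRicciAND (S.g μ) x (S.k x) := by
  simp only [IsRicciAND, g_k, S.ricci_k hgeo μ x (S.k_null x)]

theorem isSingleRicciAND_k_iff (hgeo : IsGeodesic S.gbar S.k) (μ : P) (x : M) :
    IsSingleRicciAND S.gbar x (S.k x) ↔ IsSingleRicciAND (S.g μ) x (S.k x) := by
  refine and_congr (S.isRicciAND_k_iff hgeo μ x) ⟨?_, ?_⟩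
  · rintro ⟨r, m, hf, i, hi⟩
    exact ⟨_, m, S.isNullFrame_add_smul hf, i, by rwa [S.ricci_k hgeo μ x (hf.2.2.2.1 i).1]⟩
  · rintro ⟨r, m, hf, i, hi⟩
    have hf' := S.isNullFrame_sub_smul hf
    exact ⟨_, m, hf', i, by rwa [← S.ricci_k hgeo μ x (hf'.2.2.2.1 i).1]⟩

theorem isMultipleRicciAND_k_iff (hgeo : IsGeodesic S.gbar S.k) (μ : P) (x : M) :
    IsMultipleRicciAND S.gbar x (S.k x) ↔ IsMultipleRicciAND (S.g μ) x (S.k x) := by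
  refine and_congr (S.isRicciAND_k_iff hgeo μ x) ⟨fun h r m hf i ↦ ?_, fun h r m hf i ↦ ?_⟩
  · have hf' := S.isNullFrame_sub_smul hf
    rw [S.ricci_k hgeo μ x (hf'.2.2.2.1 i).1]
    exact h _ m hf' i
  · rw [← S.ricci_k hgeo μ x (hf.2.2.2.1 i).1]
    exact h _ m (S.isNullFrame_add_smul hf) i

theorem tendsto_H_zero (x : M) : Tendsto (fun μ ↦ S.H μ x) (𝓝 S.origin) (𝓝 0) := by
  have h := S.tendsto_H x 0 (by norm_num)
  have h2 := ((ContinuousMultilinearMap.apply ℝ (fun _ : Fin 0 ↦ EuclideanSpace ℝ (Fin n)) ℝ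
    0).continuous.tendsto _).comp h
  simpa [Function.comp_def] using h2

theorem tendsto_pd_H (x : M) (i : Fin n) :
    Tendsto (fun μ ↦ pd i (fun y ↦ S.H μ ((extChartAt (𝓡 n) x).symm y)) (extChartAt (𝓡 n) x x))
      (𝓝 S.origin) (𝓝 0) := by
  have h := S.tendsto_H x 1 (by norm_num)
  have h2 := ((ContinuousMultilinearMap.apply ℝ (fun _ : Fin 1 ↦ EuclideanSpace ℝ (Fin n)) ℝ
    ![EuclideanSpace.single i 1]).continuous.tendsto _).comp h
  simpa [Function.comp_def, iteratedFDeriv_one_apply, pd] using h2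

theorem tendsto_pd_pd_H (x : M) (i j : Fin n) :
    Tendsto (fun μ ↦ pd i (pd j (fun y ↦ S.H μ ((extChartAt (𝓡 n) x).symm y)))
      (extChartAt (𝓡 n) x x)) (𝓝 S.origin) (𝓝 0) := by
  have h := S.tendsto_H x 2 le_rfl
  have h2 := ((ContinuousMultilinearMap.apply ℝ (fun _ : Fin 2 ↦ EuclideanSpace ℝ (Fin n)) ℝ
    ![EuclideanSpace.single i 1, EuclideanSpace.single j 1]).continuous.tendsto _).comp h
  simp only [pd_pd_eq (S.smooth_H_symm _ (mem_extChartAt_target (I := 𝓡 n) x))]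
  simpa [Function.comp_def, iteratedFDeriv_two_apply] using h2

theorem tendsto_ric_g (x : M) (b c : Fin n) :
    Tendsto (fun μ ↦ ric (metricMat (S.g μ) x) b c (extChartAt (𝓡 n) x x)) (𝓝 S.origin)
      (𝓝 (ric (metricMat S.gbar x) b c (extChartAt (𝓡 n) x x))) := by
  have hmem := mem_extChartAt_target (I := 𝓡 n) x
  have hdiff : ∀ μ, DifferentiableAt ℝ (fun y ↦ S.H μ ((extChartAt (𝓡 n) x).symm y))
    (extChartAt (𝓡 n) x x) := fun μ ↦ smooth_diff (S.smooth_H_symm μ hmem)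
  have h2 : TameFamily (𝓝 S.origin) (extChartAt (𝓡 n) x x) (fun _ _ ↦ (-2 : ℝ)) :=
    tameFamily_const (differentiableAt_const _)
  have hf : VanishingFamily (𝓝 S.origin) (extChartAt (𝓡 n) x x) (fun μ ↦ S.ksFun μ x) := by
    refine h2.mul_vanishing (v := fun μ y ↦ S.H μ ((extChartAt (𝓡 n) x).symm y))
      ⟨hdiff, ?_, S.tendsto_pd_H x⟩
    simpa only [extChartAt_to_inv] using S.tendsto_H_zero x
  have hf' : ∀ d, VanishingFamily (𝓝 S.origin) (extChartAt (𝓡 n) x x)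
      (fun μ ↦ pd d (S.ksFun μ x)) := by
    intro d
    refine (h2.mul_vanishing
      (v := fun μ ↦ pd d (fun y ↦ S.H μ ((extChartAt (𝓡 n) x).symm y)))
      ⟨fun μ ↦ smooth_diff (contDiffAt_pd d (S.smooth_H_symm μ hmem)), S.tendsto_pd_H x d,
        fun i ↦ S.tendsto_pd_pd_H x i d⟩).congr fun μ ↦ ?_
    filter_upwards [(isOpen_extChartAt_target (I := 𝓡 n) x).mem_nhds hmem] with z hz
    have := pd_mul (f := fun _ ↦ (-2 : ℝ)) d (differentiableAt_const _)
      (smooth_diff (S.smooth_H_symm μ hz))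
    rw [pd_const, zero_mul, zero_add] at this
    exact this
  simp only [metricMat_g]
  exact (S.isLocalKS x).tendsto_ric_ksMat hmem (fun μ y hy ↦ S.smooth_ksFun μ hy) hf hf' b c

theorem tendsto_ricci_g (x : M) (v : TangentSpace (𝓡 n) x) :
    Tendsto (fun μ ↦ ricci (S.g μ) x (v + S.H μ x • S.k x) (v + S.H μ x • S.k x)) (𝓝 S.origin)
      (𝓝 (ricci S.gbar x v v)) := by
  have hc : ∀ a, Tendsto (fun μ ↦ comp x x (v + S.H μ x • S.k x) a) (𝓝 S.origin)
      (𝓝 (comp x x v a)) := by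
    intro a
    simp only [comp_add, comp_smul]
    simpa using ((S.tendsto_H_zero x).mul_const (comp x x (S.k x) a)).const_add (comp x x v a)
  simp only [ricci_eq]
  exact tendsto_finsetSum _ fun b _ ↦ tendsto_finsetSum _ fun c _ ↦
    ((hc b).mul (hc c)).mul (S.tendsto_ric_g x b c)

/-- If `l` were orthogonal to `k`, both metrics would agree on `(l, l)`, so `l` would be null for
the background and proportional to `k`. -/
theorem g_k_ne_zero (hn : 0 < n) {μ : P} {x : M} {l : TangentSpace (𝓡 n) x}
    (hl : S.g μ x l l = 0) (hlk : ∀ c : ℝ, l ≠ c • S.k x) : S.g μ x (S.k x) l ≠ 0 := by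
  rw [g_k]
  intro h
  rw [g_apply, h, zero_mul, mul_zero, sub_zero] at hl
  obtain ⟨c, hc⟩ := S.isLorentz.exists_smul_of_null hn (S.k_ne_zero x) (S.k_null x) hl h
  exact hlk c hc

theorem ricci_smul (g : BilinField n M) (x : M) (c : ℝ) (v : TangentSpace (𝓡 n) x) :
    ricci g x (c • v) (c • v) = c ^ 2 * ricci g x v v := by
  simp only [ricci, comp_smul, Finset.mul_sum]
  exact Finset.sum_congr rfl fun b _ ↦ Finset.sum_congr rfl fun d _ ↦ by ring

theorem isRicciAND_background {x : M} {l : P → TangentSpace (𝓡 n) x}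
    {lbar : TangentSpace (𝓡 n) x} (hl : ∀ μ, μ ≠ S.origin → IsRicciAND (S.g μ) x (l μ))
    (hne : ∀ μ, μ ≠ S.origin → S.g μ x (S.k x) (l μ) ≠ 0)
    (hlbar : ∀ μ, μ ≠ S.origin →
      lbar = (S.g μ x (S.k x) (l μ))⁻¹ • l μ - S.H μ x • S.k x) :
    IsRicciAND S.gbar x lbar := by
  have := S.origin_not_isolated
  have hL : ∀ μ, μ ≠ S.origin →
      lbar + S.H μ x • S.k x = (S.g μ x (S.k x) (l μ))⁻¹ • l μ := fun μ hμ ↦ by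
    rw [hlbar μ hμ, sub_add_cancel]
  obtain ⟨μ, hμ⟩ := (eventually_mem_nhdsWithin (a := S.origin) (s := {S.origin}ᶜ)).exists
  have hμ : μ ≠ S.origin := hμ
  have hk : S.gbar x (S.k x) lbar = 1 := by
    rw [hlbar μ hμ, map_sub, map_smul, map_smul, S.k_null, smul_zero, sub_zero, ← S.g_k μ,
      smul_eq_mul, inv_mul_cancel₀ (hne μ hμ)]
  refine ⟨fun h ↦ ?_, ?_, ?_⟩
  · rw [h, map_zero] at hk
    exact zero_ne_one hk
  -- Nullity needs just one `μ ≠ origin`: as `lbar · k = 1`, the contribution `2H` of the shift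
  -- cancels the `-2H` of the metric.
  · have h0 : S.g μ x (lbar + S.H μ x • S.k x) (lbar + S.H μ x • S.k x) = 0 := by
      rw [hL μ hμ]
      simp [(hl μ hμ).2.1]
    have hk' : S.gbar x lbar (S.k x) = 1 := by rw [S.gbar_symm, hk]
    simp only [g_apply, map_add, map_smul, add_apply, smul_apply, smul_eq_mul, hk, hk',
      S.k_null] at h0
    linarith
  -- On the punctured neighbourhood filter, nontrivial by assumption, the convergent Ricci values
  -- are all zero; `lbar` itself stays fixed.
  · refine tendsto_nhds_unique (l := 𝓝[≠] S.origin)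
      ((S.tendsto_ricci_g x lbar).mono_left nhdsWithin_le_nhds)
      (tendsto_const_nhds.congr' (f₁ := fun _ ↦ (0 : ℝ)) ?_)
    filter_upwards [self_mem_nhdsWithin (a := S.origin) (s := {S.origin}ᶜ)] with ν hν
    rw [hL ν hν, ricci_smul, (hl ν hν).2.2, mul_zero]

end GKSSpacetime

end Frames

end KerrSchild

end

theorem mainTheorem3 {n : ℕ} (hn : 3 ≤ n) {M : Type*} [TopologicalSpace M]
    [ChartedSpace (EuclideanSpace ℝ (Fin n)) M] [IsManifold (𝓡 n) ∞ M]
    {P : Type*} [TopologicalSpace P] (S : KerrSchild.GKSSpacetime n M P)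
    (hgeo : KerrSchild.IsGeodesic S.gbar S.k) :
    (∀ (μ : P) (x : M), KerrSchild.IsSingleRicciAND S.gbar x (S.k x) ↔
      KerrSchild.IsSingleRicciAND (S.g μ) x (S.k x)) ∧
    (∀ (μ : P) (x : M), KerrSchild.IsMultipleRicciAND S.gbar x (S.k x) ↔
      KerrSchild.IsMultipleRicciAND (S.g μ) x (S.k x)) ∧
    (∀ (x : M) (l : P → TangentSpace (𝓡 n) x) (lbar : TangentSpace (𝓡 n) x),
      (∀ μ, μ ≠ S.origin → KerrSchild.IsRicciAND (S.g μ) x (l μ)) →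
      (∀ μ, μ ≠ S.origin → ∀ c : ℝ, l μ ≠ c • S.k x) →
      (∀ μ, μ ≠ S.origin →
        lbar = (S.g μ x (S.k x) (l μ))⁻¹ • l μ - S.H μ x • S.k x) →
      (∀ μ, μ ≠ S.origin → S.g μ x (S.k x) (l μ) ≠ 0) ∧
        KerrSchild.IsRicciAND S.gbar x lbar) := by
  refine ⟨S.isSingleRicciAND_k_iff hgeo, S.isMultipleRicciAND_k_iff hgeo,
    fun x l lbar hl hlk hlbar ↦ ?_⟩
  have hne : ∀ μ, μ ≠ S.origin → S.g μ x (S.k x) (l μ) ≠ 0 := fun μ hμ ↦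
    S.g_k_ne_zero (by omega) (hl μ hμ).2.1 (hlk μ hμ)
  exact ⟨hne, S.isRicciAND_background hl hne hlbar⟩
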